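/- Let $f:\mathbb{R}\to\mathbb{R}$ be of class $C^{7}$ with $f, f',\dots,f^{(7)}\in L^{1}(\mathbb{R})$, and let $\gamma\in(0,1)\cup(1,2]$. Let $n$ be the smallest integer greater than $\gamma$. The left- and right-sided Riemann--Liouville derivatives of $f$ on the real line are $$D_{+}^{\gamma}f(x)=\frac{1}{\Gamma(n-\gamma)}\frac{d^{n}}{dx^{n}}\int_{-\infty}^{x}\frac{f(\xi)}{(x-\xi)^{\gamma-n+1}}\,d\xi,\qquad D_{-}^{\gamma}f(x)=\frac{(-1)^{n}}{\Gamma(n-\gamma)}\frac{d^{n}}{dx^{n}}\int_{x}^{\infty}\frac{f(\xi)}{(\xi-x)^{\gamma-n+1}}\,d\xi,$$ and the Riesz fractional derivative of $f$ is $$\frac{\partial^{\gamma}f(x)}{\partial|x|^{\gamma}}=-\frac{1}{2\cos(\pi\gamma/2)}\left(D_{+}^{\gamma}f(x)+D_{-}^{\gamma}f(x)\right).$$ For $k\in\mathbb{Z}$, $r\in\mathbb{Z}$ and $h>0$ put $$\omega_{k}^{(\gamma)}=\frac{(-1)^{k}\,\Gamma(\gamma+1)}{\Gamma(\frac{\gamma}{2}-k+1)\,\Gamma(\frac{\gamma}{2}+k+1)},\qquad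 \mathcal{H}_{r}^{(\gamma)}f(x)=\sum_{k=-\infty}^{\infty}\omega_{k}^{(\gamma)}f(x-(k+r)h)$$ (with $1/\Gamma=0$ at the poles of $\Gamma$), and let $\varrho_{-1}^{(\gamma)}=\varrho_{1}^{(\gamma)}=-\frac{\gamma}{24}$, $\varrho_{0}^{(\gamma)}=1+\frac{\gamma}{12}$. Then the Riesz derivative $\partial^{\gamma}f/\partial|x|^{\gamma}$ exists at every point of $\mathbb{R}$ (both integrals above converge absolutely for every $x$ and are $n$ times continuously differentiable functions of $x$), the series $\mathcal{H}_{r}^{(\gamma)}f(x)$ converges absolutely for all $h>0$, $r\in\mathbb{Z}$ and $x\in\mathbb{R}$, and $$\frac{\partial^{\gamma}f(x)}{\partial|x|^{\gamma}}=-h^{-\gamma}\sum_{r=-1}^{1}\varrho_{r}^{(\gamma)}\,\mathcal{H}_{r}^{(\gamma)}f(x)+\mathcal{O}(h^{4})\qquad\text{as } h\to0^{+},$$ uniformly in $x\in\mathbb{R}$ (the implied constant may depend on $f$ and $\gamma$). -/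

import Mathlib

open MeasureTheory Filter Topology

noncomputable section

/-- The smallest integer `n` greater than `γ` (for `γ ≥ 0`). -/
def rlOrder (γ : ℝ) : ℕ := ⌊γ⌋₊ + 1

/-- `∫_{-∞}^x f(ξ) / (x - ξ)^(γ - n + 1) dξ`, where `n` is the smallest integer greater
than `γ`. -/
def leftRLIntegral (γ : ℝ) (f : ℝ → ℝ) (x : ℝ) : ℝ :=
  ∫ ξ in Set.Iio x, f ξ / (x - ξ) ^ (γ - (rlOrder γ : ℝ) + 1)

/-- `∫_x^∞ f(ξ) / (ξ - x)^(γ - n + 1) dξ`, where `n` is the smallest integer greater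
than `γ`. -/
def rightRLIntegral (γ : ℝ) (f : ℝ → ℝ) (x : ℝ) : ℝ :=
  ∫ ξ in Set.Ioi x, f ξ / (ξ - x) ^ (γ - (rlOrder γ : ℝ) + 1)

/-- Left-sided Riemann-Liouville derivative of order `γ` on the real line. -/
def leftRLDeriv (γ : ℝ) (f : ℝ → ℝ) (x : ℝ) : ℝ :=
  1 / Real.Gamma ((rlOrder γ : ℝ) - γ) * iteratedDeriv (rlOrder γ) (leftRLIntegral γ f) x

/-- Right-sided Riemann-Liouville derivative of order `γ` on the real line. -/
def rightRLDeriv (γ : ℝ) (f : ℝ → ℝ) (x : ℝ) : ℝ :=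
  (-1) ^ rlOrder γ / Real.Gamma ((rlOrder γ : ℝ) - γ) *
    iteratedDeriv (rlOrder γ) (rightRLIntegral γ f) x

/-- The Riesz fractional derivative of order `γ` on the real line. -/
def rieszDeriv (γ : ℝ) (f : ℝ → ℝ) (x : ℝ) : ℝ :=
  -(1 / (2 * Real.cos (Real.pi * γ / 2))) * (leftRLDeriv γ f x + rightRLDeriv γ f x)

/-- The Riesz derivative of order `γ` of `f` exists at every point: the two defining integrals
converge absolutely everywhere, and are `n` times continuously differentiable in `x`. -/
structure RieszDifferentiable (γ : ℝ) (f : ℝ → ℝ) : Prop where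
  left_integrable : ∀ x : ℝ,
    IntegrableOn (fun ξ : ℝ => f ξ / (x - ξ) ^ (γ - (rlOrder γ : ℝ) + 1)) (Set.Iio x)
  right_integrable : ∀ x : ℝ,
    IntegrableOn (fun ξ : ℝ => f ξ / (ξ - x) ^ (γ - (rlOrder γ : ℝ) + 1)) (Set.Ioi x)
  left_contDiff : ContDiff ℝ (rlOrder γ) (leftRLIntegral γ f)
  right_contDiff : ContDiff ℝ (rlOrder γ) (rightRLIntegral γ f)

/-- The coefficients of the fractional centered difference. Since `Real.Gamma` is `0` at the
poles of the Gamma function, and division by `0` gives `0`, the convention `1 / Γ = 0` at the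
poles is respected. -/
def omegaCoeff (γ : ℝ) (k : ℤ) : ℝ :=
  (-1) ^ k * Real.Gamma (γ + 1) /
    (Real.Gamma (γ / 2 - (k : ℝ) + 1) * Real.Gamma (γ / 2 + (k : ℝ) + 1))

/-- The weights `ϱ₋₁ = ϱ₁ = -γ/24`, `ϱ₀ = γ/12 + 1` (only used for `r = -1, 0, 1`). -/
def rhoWeight (γ : ℝ) (r : ℤ) : ℝ :=
  if r = 0 then γ / 12 + 1 else -(γ / 24)

/-- The shifted fractional centered difference
`H_r f(x) = ∑_{k ∈ ℤ} ω_k f(x - (k + r) h)`. -/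
def shiftedDiff (γ h : ℝ) (r : ℤ) (f : ℝ → ℝ) (x : ℝ) : ℝ :=
  ∑' k : ℤ, omegaCoeff γ k * f (x - ((k : ℝ) + (r : ℝ)) * h)

end

/-!
Write `f̂` for the Fourier transform of `f`. For `0 < γ < 2`, `γ ≠ 1`, both the Riesz derivative
and the corrected centred difference are Fourier multipliers, and the theorem compares their
symbols.

* The one-sided derivatives have symbols `(±2πiξ)^γ`: differentiation passes under the integral
  sign (`hasDerivAt_leftFracIntegral`), and the remaining fractional integral is computed after
  inserting a factor `e^(-εt)`, applying Fubini and the Gamma integral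
  `integral_rpow_mul_cexp_neg_mul_Ioi`, and letting `ε → 0`. Since
  `(iy)^γ + (-iy)^γ = 2 cos(πγ/2) |y|^γ`, the Riesz derivative has symbol `-|2πξ|^γ`
  (`HasIntegrableDerivs.rieszDeriv_eq_integral`).
* The `ω_k` are the Fourier coefficients of `|2 sin u|^γ` (`hasSum_omegaCoeff_mul_exp`): both
  sequences satisfy the same two-term recursion, and they agree at `k = 0` by the Beta integral
  and Legendre's duplication formula. Hence the scheme has symbol
  `-h^(-γ) |2 sin(θ/2)|^γ (1 + (γ/12)(1 - cos θ))` with `θ = 2πhξ`.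
* These symbols differ by `O(h⁴ |ξ|^(γ+4))` (`exists_symbol_bound`), and `|ξ|^(γ+4) f̂` is
  integrable because `f̂` and `ξ⁷ f̂` are bounded and `γ + 4 - 7 < -1`.

At `γ = 2` the last integrability fails. There `ω_k = 0` for `|k| ≥ 2`, the Riesz derivative is
`f''`, the scheme is the five-point difference for `f''`, and Taylor's formula with the bounded
derivative `f⁽⁶⁾` gives the estimate.
-/

/-! ### The coefficients of the fractional centred difference -/

/-- Wallis' integral for a real exponent: the zeroth Fourier coefficient of `|2 sin u| ^ γ`. -/
lemma integral_sin_rpow {γ : ℝ} (hγ : 0 < γ) :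
    ∫ u in (0 : ℝ)..Real.pi, (2 * Real.sin u) ^ γ =
      Real.pi * (Real.Gamma (γ + 1) / Real.Gamma (γ / 2 + 1) ^ 2) := by
  have hb : 0 < (γ + 1) / 2 := by linarith
  have hre : 0 < (((γ + 1) / 2 : ℝ) : ℂ).re := by simpa using hb
  set p : ℝ := (γ + 1) / 2 with hp
  -- the Beta integral `B(p, p)` in real form
  have hbeta_eq : ∀ x ∈ Set.Icc (0 : ℝ) 1, ((x : ℂ) ^ ((p : ℂ) - 1) * (1 - (x : ℂ)) ^ ((p : ℂ) - 1))
      = (((x * (1 - x)) ^ (p - 1) : ℝ) : ℂ) := by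
    intro x hx
    rw [Real.mul_rpow hx.1 (by linarith [hx.2]), Complex.ofReal_mul,
      Complex.ofReal_cpow hx.1, Complex.ofReal_cpow (by linarith [hx.2])]
    push_cast
    rfl
  have hconv := Complex.betaIntegral_convergent hre hre
  have hint1 : IntervalIntegrable (fun x : ℝ => (((x * (1 - x)) ^ (p - 1) : ℝ) : ℂ)) volume 0 1 := by
    refine (intervalIntegrable_congr fun x hx => ?_).mp hconv
    rw [Set.uIoc_of_le zero_le_one] at hx
    exact hbeta_eq x (Set.Ioc_subset_Icc_self hx)
  have hint : IntegrableOn (fun x : ℝ => (x * (1 - x)) ^ (p - 1)) (Set.Icc 0 1) := by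
    rw [intervalIntegrable_iff_integrableOn_Icc_of_le zero_le_one] at hint1
    have h := MeasureTheory.Integrable.re hint1
    simpa [IntegrableOn] using h
  have hbeta : ((∫ x in (0 : ℝ)..1, (x * (1 - x)) ^ (p - 1) : ℝ) : ℂ)
      = Complex.betaIntegral p p := by
    rw [Complex.betaIntegral, ← intervalIntegral.integral_ofReal]
    refine (intervalIntegral.integral_congr ?_).symm
    intro x hx
    rw [Set.uIcc_of_le zero_le_one] at hx
    exact hbeta_eq x hx
  have hG : Real.Gamma p * Real.Gamma p =
      Real.Gamma (γ + 1) * ∫ x in (0 : ℝ)..1, (x * (1 - x)) ^ (p - 1) := by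
    have h := Complex.Gamma_mul_Gamma_eq_betaIntegral hre hre
    rw [← hbeta, ← Complex.ofReal_add, Complex.Gamma_ofReal, Complex.Gamma_ofReal] at h
    have h2 : p + p = γ + 1 := by rw [hp]; ring
    rw [h2] at h
    exact_mod_cast h
  -- the substitution `x = (1 - cos u) / 2`, for which `x (1 - x) = (sin u / 2) ^ 2`
  have hprod : ∀ u : ℝ, (1 - Real.cos u) / 2 * (1 - (1 - Real.cos u) / 2) = (Real.sin u / 2) ^ 2 := by
    intro u
    have := Real.sin_sq_add_cos_sq u
    nlinarith
  have hker : ∀ u ∈ Set.Icc (0 : ℝ) Real.pi,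
      ((1 - Real.cos u) / 2 * (1 - (1 - Real.cos u) / 2)) ^ (p - 1) * (Real.sin u / 2)
        = 4 ^ (-γ) * (2 * Real.sin u) ^ γ := by
    intro u hu
    have hs := Real.sin_nonneg_of_mem_Icc hu
    rw [hprod, ← Real.rpow_natCast, ← Real.rpow_mul (by positivity)]
    have e : ((2 : ℕ) : ℝ) * (p - 1) = γ - 1 := by rw [hp]; push_cast; ring
    rw [e, Real.rpow_neg (by norm_num), show 2 * Real.sin u = 4 * (Real.sin u / 2) by ring,
      Real.mul_rpow (by norm_num) (by positivity), inv_mul_cancel_left₀ (by positivity)]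
    rcases hs.eq_or_lt with h0 | h0
    · rw [← h0]; simp [Real.zero_rpow hγ.ne']
    · rw [Real.rpow_sub_one (by positivity), div_mul_cancel₀ _ (by positivity)]
  have himg : (fun u => (1 - Real.cos u) / 2) '' Set.Icc 0 Real.pi ⊆ Set.Icc 0 1 := by
    rintro _ ⟨u, -, rfl⟩
    constructor <;> simp only <;> linarith [Real.neg_one_le_cos u, Real.cos_le_one u]
  have hsub := intervalIntegral.integral_comp_mul_deriv''' (a := 0) (b := Real.pi)
    (f := fun u => (1 - Real.cos u) / 2) (f' := fun u => Real.sin u / 2)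
    (g := fun x => (x * (1 - x)) ^ (p - 1)) (by fun_prop)
    (by
      intro u _
      have := ((Real.hasDerivAt_cos u).const_sub 1).div_const 2
      simpa using this.hasDerivWithinAt)
    (by
      rw [min_eq_left Real.pi_pos.le, max_eq_right Real.pi_pos.le]
      refine ContinuousOn.rpow_const (by fun_prop) ?_
      rintro _ ⟨u, hu, rfl⟩
      left
      simp only
      rw [hprod]
      have := Real.sin_pos_of_mem_Ioo hu
      positivity)
    (by
      rw [Set.uIcc_of_le Real.pi_pos.le]
      exact hint.mono_set himg)
    (by
      rw [Set.uIcc_of_le Real.pi_pos.le]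
      have hc : Continuous fun u : ℝ => 4 ^ (-γ) * (2 * Real.sin u) ^ γ :=
        continuous_const.mul ((by fun_prop : Continuous fun u : ℝ => 2 * Real.sin u).rpow_const
          fun _ => Or.inr hγ.le)
      refine (hc.continuousOn.integrableOn_Icc).congr_fun ?_ measurableSet_Icc
      intro u hu
      exact (hker u hu).symm)
  have hsub' : 4 ^ (-γ) * ∫ u in (0 : ℝ)..Real.pi, (2 * Real.sin u) ^ γ
      = ∫ x in (0 : ℝ)..1, (x * (1 - x)) ^ (p - 1) := by
    rw [← intervalIntegral.integral_const_mul]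
    simp only [Real.cos_zero, Real.cos_pi] at hsub
    norm_num at hsub
    rw [← hsub]
    refine intervalIntegral.integral_congr ?_
    intro u hu
    rw [Set.uIcc_of_le Real.pi_pos.le] at hu
    exact (hker u hu).symm
  rw [← hsub'] at hG
  have hdup := Real.Gamma_mul_Gamma_add_half p
  have e1 : p + 1 / 2 = γ / 2 + 1 := by rw [hp]; ring
  have e2 : 2 * p = γ + 1 := by rw [hp]; ring
  rw [e1, e2] at hdup
  have g1 : 0 < Real.Gamma (γ / 2 + 1) := Real.Gamma_pos_of_pos (by linarith)
  have g2 : 0 < Real.Gamma (γ + 1) := Real.Gamma_pos_of_pos (by linarith)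
  have e3 : (2 : ℝ) ^ (1 - (γ + 1)) = 2 ^ (-γ) := by congr 1; ring
  have e4 : (4 : ℝ) ^ (-γ) = 2 ^ (-γ) * 2 ^ (-γ) := by
    rw [← Real.mul_rpow (by norm_num) (by norm_num)]; norm_num
  rw [e3] at hdup
  rw [e4] at hG
  have hq : (0 : ℝ) < 2 ^ (-γ) := by positivity
  have hpi : Real.sqrt Real.pi * Real.sqrt Real.pi = Real.pi := Real.mul_self_sqrt Real.pi_pos.le
  set I := ∫ u in (0 : ℝ)..Real.pi, (2 * Real.sin u) ^ γ
  set q : ℝ := 2 ^ (-γ)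
  set A := Real.Gamma p
  set B := Real.Gamma (γ / 2 + 1)
  set G := Real.Gamma (γ + 1)
  have key : G * (q * q) * (I * B ^ 2) = G * (q * q) * (Real.pi * G) := by
    calc G * (q * q) * (I * B ^ 2) = (A * B) * (A * B) := by
          linear_combination (-B ^ 2) * hG
      _ = _ := by rw [hdup]; linear_combination (G * q) ^ 2 * hpi
  have key2 := mul_left_cancel₀ (by positivity) key
  rw [← mul_div_assoc, eq_div_iff (by positivity)]
  exact key2

lemma omegaCoeff_neg (γ : ℝ) (k : ℤ) : omegaCoeff γ (-k) = omegaCoeff γ k := by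
  unfold omegaCoeff
  have h : ((-1 : ℝ)) ^ (-k) = (-1) ^ k := by
    rw [zpow_neg, ← inv_zpow]; norm_num
  rw [h]
  push_cast
  rw [sub_neg_eq_add, ← sub_eq_add_neg, mul_comm (Real.Gamma (γ / 2 + k + 1))]

lemma half_add_intCast_ne_zero {γ : ℝ} (h0 : 0 < γ) (h2 : γ < 2) (k : ℤ) : γ / 2 + k ≠ 0 := by
  intro h
  have h1 : (-1 : ℝ) < k := by linarith
  have h3 : (k : ℝ) < 0 := by linarith
  have h1' : -1 < k := by exact_mod_cast h1
  have h3' : k < 0 := by exact_mod_cast h3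
  omega

lemma omegaCoeff_add_one {γ : ℝ} (h0 : 0 < γ) (h2 : γ < 2) (k : ℤ) :
    omegaCoeff γ (k + 1) * (γ / 2 + k + 1) = -(omegaCoeff γ k * (γ / 2 - k)) := by
  have hz := half_add_intCast_ne_zero h0 h2
  have n1 : γ / 2 - k ≠ 0 := by simpa [sub_eq_add_neg] using hz (-k)
  have n2 : γ / 2 + k + 1 ≠ 0 := by have := hz (k + 1); push_cast at this; rwa [← add_assoc] at this
  have ne : ∀ j : ℤ, Real.Gamma (γ / 2 + j) ≠ 0 := by
    intro j
    refine Real.Gamma_ne_zero fun m => ?_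
    have := hz (j + m)
    push_cast at this
    intro h
    apply this
    linarith
  have m1 : Real.Gamma (γ / 2 - k) ≠ 0 := by simpa [sub_eq_add_neg] using ne (-k)
  have m2 : Real.Gamma (γ / 2 + k + 1) ≠ 0 := by
    have := ne (k + 1); push_cast at this; rwa [← add_assoc] at this
  unfold omegaCoeff
  push_cast
  rw [zpow_add_one₀ (by norm_num), show γ / 2 - (k + 1 : ℝ) + 1 = γ / 2 - k by ring,
    show γ / 2 + (k + 1 : ℝ) + 1 = (γ / 2 + k + 1) + 1 by ring, Real.Gamma_add_one n2,
    Real.Gamma_add_one n1]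
  generalize γ / 2 - k = A at *
  generalize γ / 2 + k + 1 = B at *
  field_simp

/-- The recursion for `ω_k` gives `(γ / 2) |ω_k| ≤ k |ω_k| - (k + 1) |ω_{k+1}|` for `k ≥ 1`, so
that the partial sums of `|ω_k|` are bounded by a telescoping sum. -/
lemma summable_omegaCoeff {γ : ℝ} (h0 : 0 < γ) (h2 : γ < 2) : Summable (omegaCoeff γ) := by
  have key : ∀ k : ℕ, γ / 2 * |omegaCoeff γ ((k + 1 : ℕ) : ℤ)| ≤
      (k + 1) * |omegaCoeff γ ((k + 1 : ℕ) : ℤ)| - (k + 2) * |omegaCoeff γ ((k + 2 : ℕ) : ℤ)| := by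
    intro k
    have h := congrArg abs (omegaCoeff_add_one h0 h2 ((k + 1 : ℕ) : ℤ))
    rw [abs_neg, abs_mul, abs_mul] at h
    push_cast at h ⊢
    have e1 : |γ / 2 + ((k : ℝ) + 1) + 1| = γ / 2 + k + 2 := by
      rw [abs_of_pos (by positivity)]; ring
    have e2 : |γ / 2 - ((k : ℝ) + 1)| = k + 1 - γ / 2 := by
      rw [abs_of_nonpos (by have : (0 : ℝ) ≤ k := k.cast_nonneg; linarith)]; ring
    rw [e1, e2, add_assoc (k : ℤ) 1 1, one_add_one_eq_two] at h
    have : 0 ≤ γ / 2 * |omegaCoeff γ ((k : ℤ) + 2)| := by positivity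
    linarith
  have hs : Summable fun k : ℕ => |omegaCoeff γ ((k + 1 : ℕ) : ℤ)| := by
    refine summable_of_sum_range_le (c := 2 / γ * |omegaCoeff γ 1|) (fun _ => abs_nonneg _) ?_
    intro n
    have hb : γ / 2 * ∑ k ∈ Finset.range n, |omegaCoeff γ ((k + 1 : ℕ) : ℤ)| ≤
        |omegaCoeff γ 1| - (n + 1) * |omegaCoeff γ ((n + 1 : ℕ) : ℤ)| := by
      induction n with
      | zero => simp
      | succ n ih =>
        rw [Finset.sum_range_succ, mul_add]
        have := key n
        push_cast at ih this ⊢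
        rw [add_assoc (n : ℤ) 1 1, one_add_one_eq_two]
        linarith
    have h3 : 0 ≤ ((n : ℝ) + 1) * |omegaCoeff γ ((n + 1 : ℕ) : ℤ)| := by positivity
    rw [div_mul_eq_mul_div, le_div_iff₀ h0]
    linarith
  have hs' : Summable fun k : ℕ => omegaCoeff γ (k : ℤ) :=
    (summable_nat_add_iff 1).mp hs.of_abs
  refine Summable.of_nat_of_neg hs' ?_
  simpa only [omegaCoeff_neg] using hs'

/-- The Fourier coefficients of `|2 sin u| ^ γ`: they satisfy the recursion of the `ω_k`, and
agree with them at `k = 0`. -/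
lemma intervalIntegral_exp_mul_sin_rpow {γ : ℝ} (h0 : 0 < γ) (h2 : γ < 2) (k : ℤ) :
    ∫ u in (0 : ℝ)..Real.pi, Complex.exp (-(2 * k * u * Complex.I)) * ((2 * Real.sin u) ^ γ : ℝ)
      = Real.pi * omegaCoeff γ k := by
  set c : ℤ → ℂ := fun k =>
    ∫ u in (0 : ℝ)..Real.pi, Complex.exp (-(2 * k * u * Complex.I)) * ((2 * Real.sin u) ^ γ : ℝ)
    with hc
  have hcont : Continuous fun u : ℝ => (((2 * Real.sin u) ^ γ : ℝ) : ℂ) :=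
    Complex.continuous_ofReal.comp
      ((by fun_prop : Continuous fun u : ℝ => 2 * Real.sin u).rpow_const fun _ => Or.inr h0.le)
  have hI : ∀ k : ℤ, IntervalIntegrable (fun u : ℝ =>
      Complex.exp (-(2 * k * u * Complex.I)) * ((2 * Real.sin u) ^ γ : ℝ)) volume 0 Real.pi :=
    fun k => ((by fun_prop : Continuous fun u : ℝ =>
      Complex.exp (-(2 * k * u * Complex.I))).mul hcont).intervalIntegrable _ _
  -- integrate the derivative of `(2 sin u) ^ (γ + 1) * exp (-i (2 k + 1) u)` over `[0, π]`
  have hrec : ∀ k : ℤ, c (k + 1) * (γ / 2 + k + 1) = -(c k * (γ / 2 - k)) := by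
    intro k
    have hd : ∀ u ∈ Set.uIcc (0 : ℝ) Real.pi, HasDerivAt (fun u : ℝ =>
        Complex.exp (-((2 * k + 1) * u * Complex.I)) * ((2 * Real.sin u) ^ (γ + 1) : ℝ))
        (2 * (γ / 2 - k) * (Complex.exp (-(2 * k * u * Complex.I)) * ((2 * Real.sin u) ^ γ : ℝ)) +
          2 * (γ / 2 + k + 1) * (Complex.exp (-(2 * (k + 1 : ℤ) * u * Complex.I)) *
            ((2 * Real.sin u) ^ γ : ℝ))) u := by
      intro u hu
      rw [Set.uIcc_of_le Real.pi_pos.le] at hu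
      have hs : 0 ≤ 2 * Real.sin u := by linarith [Real.sin_nonneg_of_mem_Icc hu]
      have d1 : HasDerivAt (fun u : ℝ => (2 * Real.sin u) ^ (γ + 1))
          (2 * Real.cos u * (γ + 1) * (2 * Real.sin u) ^ (γ + 1 - 1)) u :=
        ((Real.hasDerivAt_sin u).const_mul 2).rpow_const (Or.inr (by linarith))
      have d2 : HasDerivAt (fun u : ℝ => Complex.exp (-((2 * k + 1) * u * Complex.I)))
          (Complex.exp (-((2 * k + 1) * u * Complex.I)) * (-((2 * k + 1) * 1 * Complex.I))) u :=
        (((Complex.ofRealCLM.hasDerivAt (x := u)).const_mul (2 * (k : ℂ) + 1)).mul_const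
          Complex.I).neg.cexp
      refine (d2.mul d1.ofReal_comp).congr_deriv ?_
      have e1 : (2 * Real.sin u) ^ (γ + 1) = (2 * Real.sin u) ^ γ * (2 * Real.sin u) := by
        rw [Real.rpow_add_one' hs (by linarith)]
      rw [e1, add_sub_cancel_right]
      have x1 : Complex.exp (-(2 * k * u * Complex.I)) =
          Complex.exp (-((2 * k + 1) * u * Complex.I)) * Complex.exp (u * Complex.I) := by
        rw [← Complex.exp_add]; congr 1; ring
      have x2 : Complex.exp (-(2 * (k + 1 : ℤ) * u * Complex.I)) =
          Complex.exp (-((2 * k + 1) * u * Complex.I)) * Complex.exp (-(u * Complex.I)) := by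
        rw [← Complex.exp_add]; congr 1; push_cast; ring
      have x3 : Complex.exp (u * Complex.I) = Complex.cos u + Complex.sin u * Complex.I :=
        Complex.exp_mul_I u
      have x4 : Complex.exp (-(u * Complex.I)) = Complex.cos u - Complex.sin u * Complex.I := by
        rw [← neg_mul, Complex.exp_mul_I, Complex.cos_neg, Complex.sin_neg]; ring
      rw [x1, x2, x3, x4]
      push_cast
      ring
    have h := intervalIntegral.integral_eq_sub_of_hasDerivAt hd
      (((hI k).const_mul _).add ((hI (k + 1)).const_mul _))
    rw [intervalIntegral.integral_add ((hI k).const_mul _) ((hI (k + 1)).const_mul _),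
      intervalIntegral.integral_const_mul, intervalIntegral.integral_const_mul] at h
    simp only [Real.sin_pi, Real.sin_zero, mul_zero, Real.zero_rpow (by linarith : γ + 1 ≠ 0),
      Complex.ofReal_zero, sub_zero] at h
    change 2 * (γ / 2 - k) * c k + 2 * (γ / 2 + k + 1) * c (k + 1) = 0 at h
    linear_combination h / 2
  have hω : ∀ k : ℤ, (omegaCoeff γ (k + 1) : ℂ) * (γ / 2 + k + 1) =
      -(omegaCoeff γ k * (γ / 2 - k)) := fun k => by
    exact_mod_cast congrArg Complex.ofReal (omegaCoeff_add_one h0 h2 k)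
  have hz := half_add_intCast_ne_zero h0 h2
  have n1 : ∀ k : ℤ, (γ / 2 - k : ℂ) ≠ 0 := fun k => by
    have := hz (-k)
    push_cast at this
    rw [← sub_eq_add_neg] at this
    exact_mod_cast this
  have n2 : ∀ k : ℤ, (γ / 2 + k + 1 : ℂ) ≠ 0 := fun k => by
    have := hz (k + 1)
    push_cast at this
    rw [← add_assoc] at this
    exact_mod_cast this
  have hzero : c 0 = Real.pi * omegaCoeff γ 0 := by
    have : c 0 = ((∫ u in (0 : ℝ)..Real.pi, (2 * Real.sin u) ^ γ : ℝ) : ℂ) := by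
      rw [hc, ← intervalIntegral.integral_ofReal]
      simp
    rw [this, integral_sin_rpow h0]
    simp [omegaCoeff, sq]
  change c k = _
  induction k using Int.induction_on with
  | zero => exact hzero
  | succ i ih =>
    refine mul_right_cancel₀ (n2 i) ?_
    linear_combination hrec i - Real.pi * hω i - (γ / 2 - (i : ℤ)) * ih
  | pred i ih =>
    have a1 := hrec (-(i : ℤ) - 1)
    have a2 := hω (-(i : ℤ) - 1)
    rw [sub_add_cancel] at a1 a2
    refine mul_right_cancel₀ (n1 (-(i : ℤ) - 1)) ?_
    linear_combination a1 - Real.pi * a2 - (γ / 2 + ((-(i : ℤ) - 1 : ℤ) : ℂ) + 1) * ih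

/-- The generating function of the coefficients: `∑ ω_k e^{2iku} = |2 sin u| ^ γ`. -/
lemma hasSum_omegaCoeff_mul_exp {γ : ℝ} (h0 : 0 < γ) (h2 : γ < 2) (u : ℝ) :
    HasSum (fun k : ℤ => (omegaCoeff γ k : ℂ) * Complex.exp (2 * k * u * Complex.I))
      ((|2 * Real.sin u| ^ γ : ℝ) : ℂ) := by
  have : Fact (0 < Real.pi) := ⟨Real.pi_pos⟩
  set F : ℝ → ℂ := fun u => ((|2 * Real.sin u| ^ γ : ℝ) : ℂ) with hF
  have hper : Function.Periodic F Real.pi := by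
    intro x
    simp only [hF, Real.sin_add_pi, mul_neg, abs_neg]
  have hcont : Continuous F :=
    Complex.continuous_ofReal.comp
      ((by fun_prop : Continuous fun u : ℝ => |2 * Real.sin u|).rpow_const fun _ => Or.inr h0.le)
  let g : C(AddCircle Real.pi, ℂ) := ⟨hper.lift, continuous_coinduced_dom.mpr hcont⟩
  have hg : ∀ x : ℝ, g (x : AddCircle Real.pi) = F x := fun x => hper.lift_coe x
  have hfour : ∀ (n : ℤ) (x : ℝ), fourier n (x : AddCircle Real.pi) =
      Complex.exp (2 * n * x * Complex.I) := by
    intro n x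
    rw [fourier_coe_apply]
    congr 1
    have : (Real.pi : ℂ) ≠ 0 := by exact_mod_cast Real.pi_ne_zero
    field_simp
  have hcoeff : ∀ n : ℤ, fourierCoeff g n = omegaCoeff γ n := by
    intro n
    rw [fourierCoeff_eq_intervalIntegral _ n 0, zero_add]
    have : ∫ x in (0 : ℝ)..Real.pi, fourier (-n) (x : AddCircle Real.pi) • g x =
        ∫ u in (0 : ℝ)..Real.pi, Complex.exp (-(2 * n * u * Complex.I)) *
          ((2 * Real.sin u) ^ γ : ℝ) := by
      refine intervalIntegral.integral_congr ?_
      intro u hu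
      rw [Set.uIcc_of_le Real.pi_pos.le] at hu
      simp only
      rw [hfour, hg, hF, smul_eq_mul]
      simp only
      rw [abs_of_nonneg (by linarith [Real.sin_nonneg_of_mem_Icc hu])]
      congr 2
      push_cast
      ring
    rw [this, intervalIntegral_exp_mul_sin_rpow h0 h2]
    have : (Real.pi : ℂ) ≠ 0 := by exact_mod_cast Real.pi_ne_zero
    rw [Complex.real_smul]
    push_cast
    field_simp
  have hsum : Summable (fourierCoeff g) := by
    have : fourierCoeff g = fun n => (omegaCoeff γ n : ℂ) := funext hcoeff
    rw [this]
    exact (Complex.hasSum_ofReal.mpr (summable_omegaCoeff h0 h2).hasSum).summable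
  have h := has_pointwise_sum_fourier_series_of_summable hsum (u : AddCircle Real.pi)
  rw [hg] at h
  simpa only [hcoeff, hfour, smul_eq_mul] using h

/-! ### Comparison of the symbols -/

lemma abs_rpow_one_sub_sub_le {p y : ℝ} (hp0 : 0 ≤ p) (hp1 : p ≤ 1) (hy0 : 0 ≤ y)
    (hy1 : y ≤ 1 / 2) : |(1 - y) ^ p - (1 - p * y)| ≤ y ^ 2 := by
  have hup : (1 - y) ^ p ≤ 1 - p * y := by
    have := rpow_one_add_le_one_add_mul_self (s := -y) (by linarith) hp0 hp1
    simpa [sub_eq_add_neg] using this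
  have hb : 0 < 1 - y := by linarith
  -- the lower bound is Bernoulli's inequality for `(1 - y)⁻¹ = 1 + y / (1 - y)`
  have hlow : 1 - p * y - y ^ 2 ≤ (1 - y) ^ p := by
    have h1 := rpow_one_add_le_one_add_mul_self (s := y / (1 - y))
      (by have : 0 ≤ y / (1 - y) := by positivity
          linarith) hp0 hp1
    have h2 : 1 + y / (1 - y) = (1 - y)⁻¹ := by field_simp; ring
    rw [h2, Real.inv_rpow hb.le] at h1
    have hpos : 0 < (1 - y) ^ p := by positivity
    have h3 : 1 + p * (y / (1 - y)) = (1 - y + p * y) / (1 - y) := by field_simp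
    rw [h3, inv_le_comm₀ hpos (by have : 0 ≤ p * y := by positivity
                                  positivity), inv_div] at h1
    refine le_trans ?_ h1
    rw [le_div_iff₀ (by have : 0 ≤ p * y := by positivity
                        linarith)]
    have : 0 ≤ p * y := by positivity
    nlinarith [mul_nonneg hp0 (sub_nonneg.2 hp1), sq_nonneg y, sq_nonneg (p - 1 / 2),
      mul_nonneg (sq_nonneg y) (sub_nonneg.2 hy1), mul_nonneg (mul_nonneg hp0 hy0) (sq_nonneg y),
      mul_nonneg (sq_nonneg (p - 1 / 2)) (sq_nonneg y)]
  rw [abs_le]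
  constructor <;> nlinarith [sq_nonneg y]

/-- The algebraic core of `exists_symbol_bound`, with `w = (θ / 2)²`,
`y = 1 - (sin(θ / 2) / (θ / 2))²` and `e` the remainder of `(1 - y)^(γ / 2)`. -/
lemma abs_one_sub_mul_le {γ w y e : ℝ} (h0 : 0 < γ) (h2 : γ < 2) (hw0 : 0 ≤ w)
    (hw : w ≤ 1 / 4) (hyl : w / 3 - w ^ 2 / 10 ≤ y) (hyu : y ≤ w / 3 + w ^ 2 / 50)
    (hy0 : 0 ≤ y) (he : |e| ≤ y ^ 2) :
    |1 - ((1 - γ / 2 * y) + e) * (1 + γ / 6 * w * (1 - y))| ≤ 5 * w ^ 2 := by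
  have hyw : y ≤ w := by nlinarith
  have h1y : 0 ≤ 1 - y := by linarith
  have h1y' : 1 - y ≤ 1 := by linarith
  -- the terms of first order cancel
  have hexp : 1 - ((1 - γ / 2 * y) + e) * (1 + γ / 6 * w * (1 - y)) =
      γ / 2 * (y - w / 3) + γ / 6 * (w * y) + γ ^ 2 / 12 * (w * y) * (1 - y)
        - e * (1 + γ / 6 * w * (1 - y)) := by ring
  rw [hexp]
  have hwn : 0 ≤ w ^ 2 := by positivity
  have hwy : w * y ≤ w ^ 2 := by rw [sq]; gcongr
  have hwy0 : 0 ≤ w * y := by positivity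
  have b1 : |γ / 2 * (y - w / 3)| ≤ 1 * w ^ 2 := by
    rw [abs_mul, abs_of_pos (by positivity)]
    have : |y - w / 3| ≤ w ^ 2 := by rw [abs_le]; constructor <;> linarith
    gcongr
    linarith
  have b2 : |γ / 6 * (w * y)| ≤ 1 * w ^ 2 := by
    rw [abs_of_nonneg (by positivity)]
    gcongr
    linarith
  have b3 : |γ ^ 2 / 12 * (w * y) * (1 - y)| ≤ 1 * w ^ 2 * 1 := by
    rw [abs_of_nonneg (by positivity)]
    have hg : γ ^ 2 / 12 ≤ 1 := by nlinarith
    gcongr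
  have b4 : |e * (1 + γ / 6 * w * (1 - y))| ≤ w ^ 2 * 2 := by
    rw [abs_mul, abs_of_nonneg (a := 1 + _) (by positivity)]
    have he2 : |e| ≤ w ^ 2 := he.trans (by gcongr)
    have hf : γ / 6 * w * (1 - y) ≤ 1 * 1 * 1 := by
      gcongr <;> linarith
    gcongr
    linarith
  refine (abs_sub _ _).trans ?_
  have t1 := abs_add_le (γ / 2 * (y - w / 3) + γ / 6 * (w * y)) (γ ^ 2 / 12 * (w * y) * (1 - y))
  have t2 := abs_add_le (γ / 2 * (y - w / 3)) (γ / 6 * (w * y))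
  linarith

/-- `sin² z = z² (1 - y)` with `y = z² / 3 + O(z⁴)`. -/
lemma one_sub_sinc_sq_bounds {z : ℝ} (hz0 : 0 < z) (hz1 : z ≤ 1 / 2) :
    0 ≤ 1 - (Real.sin z / z) ^ 2 ∧ z ^ 2 / 3 - (z ^ 2) ^ 2 / 10 ≤ 1 - (Real.sin z / z) ^ 2 ∧
      1 - (Real.sin z / z) ^ 2 ≤ z ^ 2 / 3 + (z ^ 2) ^ 2 / 50 := by
  have hsin := Real.sin_bound (x := z) (by rw [abs_of_pos hz0]; linarith)
  rw [abs_of_pos hz0, abs_le] at hsin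
  have hsp : 0 < Real.sin z := Real.sin_pos_of_pos_of_lt_pi hz0 (by linarith [Real.pi_gt_three])
  have hs1 : Real.sin z / z ≤ 1 := by rw [div_le_one hz0]; exact Real.sin_le hz0.le
  have hs0 : 0 < Real.sin z / z := by positivity
  have hsl : 1 - z ^ 2 / 6 - (z ^ 2) ^ 2 / 100 ≤ Real.sin z / z := by
    rw [le_div_iff₀ hz0]; linarith [hsin.1]
  have hsu : Real.sin z / z ≤ 1 - z ^ 2 / 6 + (z ^ 2) ^ 2 / 100 := by
    rw [div_le_iff₀ hz0]; linarith [hsin.2]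
  have hz2 : z ^ 2 ≤ 1 / 4 := by nlinarith
  have hw0 : 0 < z ^ 2 := by positivity
  generalize Real.sin z / z = s at *
  generalize z ^ 2 = w at *
  have hww : 0 ≤ w ^ 2 := by positivity
  have hw1 : w ^ 2 ≤ w / 4 := by nlinarith
  refine ⟨by nlinarith, ?_, ?_⟩
  · have h1 : s ^ 2 ≤ (1 - w / 6 + w ^ 2 / 100) ^ 2 := by gcongr
    have h2 : (w / 6 - w ^ 2 / 100) ^ 2 ≤ (w / 6) ^ 2 := by
      apply pow_le_pow_left₀ <;> linarith
    nlinarith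
  · have h1 : (1 - w / 6 - w ^ 2 / 100) ^ 2 ≤ s ^ 2 := pow_le_pow_left₀ (by linarith) hsl 2
    nlinarith [sq_nonneg (w / 6 + w ^ 2 / 100)]

/-- Fourth-order consistency of the symbol of the corrected centred difference. -/
lemma exists_symbol_bound {γ : ℝ} (h0 : 0 < γ) (h2 : γ < 2) :
    ∃ C : ℝ, ∀ θ : ℝ, |(|θ| ^ γ - |2 * Real.sin (θ / 2)| ^ γ *
      (1 + γ / 12 * (1 - Real.cos θ)))| ≤ C * |θ| ^ (γ + 4) := by
  -- for `|θ| ≥ 1` the triangle inequality suffices; for `|θ| < 1` expand with `z = θ / 2`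
  refine ⟨4, fun θ => ?_⟩
  wlog hθ : 0 ≤ θ generalizing θ
  · have := this (-θ) (by linarith)
    simpa [neg_div, abs_neg] using this
  rw [abs_of_nonneg hθ]
  have hc1 := Real.neg_one_le_cos θ
  have hc2 := Real.cos_le_one θ
  rcases le_or_gt 1 θ with h1 | h1
  · have a1 : |2 * Real.sin (θ / 2)| ≤ θ := by
      rw [abs_mul, abs_two]
      have := Real.abs_sin_le_abs (x := θ / 2)
      rw [abs_of_nonneg (by linarith : 0 ≤ θ / 2)] at this
      linarith
    have a2 : |2 * Real.sin (θ / 2)| ^ γ ≤ θ ^ γ := Real.rpow_le_rpow (abs_nonneg _) a1 h0.le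
    have a3 : θ ^ γ ≤ θ ^ (γ + 4) := Real.rpow_le_rpow_of_exponent_le h1 (by linarith)
    have a4 : 0 ≤ |2 * Real.sin (θ / 2)| ^ γ := by positivity
    have a5 : 0 ≤ γ / 12 * (1 - Real.cos θ) := by
      have : 0 ≤ 1 - Real.cos θ := by linarith
      positivity
    have a6 : γ / 12 * (1 - Real.cos θ) ≤ 1 := by nlinarith
    rw [abs_le]
    constructor <;> nlinarith
  · rcases hθ.eq_or_lt with rfl | hpos
    · simp [Real.zero_rpow h0.ne', Real.zero_rpow (by linarith : γ + 4 ≠ 0)]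
    set z := θ / 2 with hz
    have hz0 : 0 < z := by positivity
    have hz1 : z ≤ 1 / 2 := by linarith
    have hsp : 0 < Real.sin z := Real.sin_pos_of_pos_of_lt_pi hz0 (by linarith [Real.pi_gt_three])
    obtain ⟨hy0, hyl, hyu⟩ := one_sub_sinc_sq_bounds hz0 hz1
    have hz2 : z ^ 2 ≤ 1 / 4 := by nlinarith
    set s := Real.sin z / z with hs
    have hs0 : 0 < s := by positivity
    have hse : Real.sin z = s * z := by rw [hs, div_mul_cancel₀ _ hz0.ne']
    set y := 1 - s ^ 2 with hy
    set w := z ^ 2 with hw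
    have hw0 : 0 < w := by positivity
    have hyh : y ≤ 1 / 2 := by nlinarith
    have hp := abs_rpow_one_sub_sub_le (p := γ / 2) (y := y) (by linarith) (by linarith) hy0 hyh
    rw [abs_le] at hp
    have hcos : 1 - Real.cos θ = 2 * w * (1 - y) := by
      have : Real.cos θ = 1 - 2 * Real.sin z ^ 2 := by
        rw [show θ = 2 * z by rw [hz]; ring, Real.cos_two_mul, Real.cos_sq']; ring
      rw [this, hse, hy, hw]; ring
    have hpow : |2 * Real.sin z| ^ γ = θ ^ γ * (1 - y) ^ (γ / 2) := by
      have e : (1 - y) = s ^ (2 : ℝ) := by rw [hy]; norm_num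
      rw [e, ← Real.rpow_mul hs0.le, mul_div_cancel₀ _ two_ne_zero, ← Real.mul_rpow hθ hs0.le,
        abs_of_pos (by positivity), hse, hz]
      congr 1; ring
    have h4 : θ ^ (γ + 4) = θ ^ γ * (16 * w ^ 2) := by
      rw [Real.rpow_add hpos, show (4 : ℝ) = ((4 : ℕ) : ℝ) by norm_num, Real.rpow_natCast, hw, hz]
      ring
    rw [hcos, hpow, h4]
    have hfac : θ ^ γ - θ ^ γ * (1 - y) ^ (γ / 2) * (1 + γ / 12 * (2 * w * (1 - y))) =
        θ ^ γ * (1 - (1 - y) ^ (γ / 2) * (1 + γ / 6 * w * (1 - y))) := by ring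
    have hθγ : 0 < θ ^ γ := by positivity
    rw [hfac, abs_mul, abs_of_pos hθγ, mul_left_comm]
    refine mul_le_mul_of_nonneg_left ?_ hθγ.le
    have hfin := abs_one_sub_mul_le h0 h2 hw0.le hz2 hyl hyu hy0 (abs_le.2 hp)
    rw [add_sub_cancel] at hfin
    refine hfin.trans ?_
    nlinarith [sq_nonneg w]

/-! ### Functions with integrable derivatives -/

/-- `f` is of class `C^N` and its derivatives of order `0, …, N` are integrable on `ℝ`. -/
structure HasIntegrableDerivs (N : ℕ) (f : ℝ → ℝ) : Prop where
  contDiff : ContDiff ℝ N f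
  integrable : ∀ j ≤ N, Integrable (iteratedDeriv j f)

namespace HasIntegrableDerivs

variable {N : ℕ} {f : ℝ → ℝ}

lemma comp_neg (hf : HasIntegrableDerivs N f) : HasIntegrableDerivs N (fun x => f (-x)) where
  contDiff := hf.contDiff.comp contDiff_neg
  integrable j hj := by
    have : iteratedDeriv j (fun x => f (-x)) = fun x => (-1 : ℝ) ^ j • iteratedDeriv j f (-x) :=
      funext fun x => iteratedDeriv_comp_neg j f x
    rw [this]
    exact (hf.integrable j hj).comp_neg.const_mul _

lemma continuous_iteratedDeriv (hf : HasIntegrableDerivs N f) {j : ℕ} (hj : j ≤ N) :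
    Continuous (iteratedDeriv j f) :=
  hf.contDiff.continuous_iteratedDeriv j (by exact_mod_cast hj)

lemma hasDerivAt_iteratedDeriv (hf : HasIntegrableDerivs N f) {j : ℕ} (hj : j < N) (x : ℝ) :
    HasDerivAt (iteratedDeriv j f) (iteratedDeriv (j + 1) f x) x := by
  rw [iteratedDeriv_succ]
  exact (hf.contDiff.differentiable_iteratedDeriv j (by exact_mod_cast hj) x).hasDerivAt

end HasIntegrableDerivs

/-- On the unit ball around `s` a function is bounded by `|g s|` plus a local integral of `|g'|`; as
a function of `s` this bound is integrable when `g` and `g'` are. -/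
lemma abs_le_add_integral_of_abs_sub_le {g g' : ℝ → ℝ} (hg : ∀ x, HasDerivAt g (g' x) x)
    (hg'c : Continuous g') {s y : ℝ} (h : |y - s| ≤ 1) :
    |g y| ≤ |g s| + ∫ u in Set.Icc (-1 : ℝ) 1, |g' (s + u)| := by
  have hFTC : ∫ u in s..y, g' u = g y - g s :=
    intervalIntegral.integral_eq_sub_of_hasDerivAt (fun x _ => hg x)
      (hg'c.intervalIntegrable _ _)
  have h1 : |∫ u in s..y, g' u| ≤ ∫ u in Set.Icc (s - 1) (s + 1), |g' u| := by
    refine (intervalIntegral.norm_integral_le_integral_norm_uIoc (f := g')).trans ?_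
    refine setIntegral_mono_set (hg'c.abs.integrableOn_Icc) (ae_of_all _ fun _ => abs_nonneg _) ?_
    refine LE.le.eventuallyLE ?_
    refine Set.uIoc_subset_uIcc.trans ?_
    rw [abs_le] at h
    refine Set.uIcc_subset_Icc ⟨by linarith, by linarith⟩ ⟨by linarith, by linarith⟩
  have h2 : ∫ u in Set.Icc (s - 1) (s + 1), |g' u| = ∫ u in Set.Icc (-1 : ℝ) 1, |g' (s + u)| := by
    rw [integral_Icc_eq_integral_Ioc, integral_Icc_eq_integral_Ioc,
      ← intervalIntegral.integral_of_le (by linarith), ← intervalIntegral.integral_of_le (by norm_num),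
      intervalIntegral.integral_comp_add_left (fun u => |g' u|), ← sub_eq_add_neg]
  rw [← h2]
  have h3 : g y = g s + ∫ u in s..y, g' u := by rw [hFTC]; ring
  rw [h3]
  exact (abs_add_le _ _).trans (by linarith)

lemma integrable_integral_Icc_abs {g' : ℝ → ℝ} (hg'c : Continuous g') (hg' : Integrable g') :
    Integrable fun s => ∫ u in Set.Icc (-1 : ℝ) 1, |g' (s + u)| := by
  have hm : AEStronglyMeasurable (fun p : ℝ × ℝ => |g' (p.1 + p.2)|)
      ((volume : Measure ℝ).prod (volume.restrict (Set.Icc (-1 : ℝ) 1))) :=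
    (hg'c.abs.comp (continuous_fst.add continuous_snd)).aestronglyMeasurable
  have : Integrable (fun p : ℝ × ℝ => |g' (p.1 + p.2)|)
      ((volume : Measure ℝ).prod (volume.restrict (Set.Icc (-1 : ℝ) 1))) := by
    rw [integrable_prod_iff' hm]
    refine ⟨ae_of_all _ fun u => (hg'.comp_add_right u).abs, ?_⟩
    have : (fun u : ℝ => ∫ s, ‖|g' (s + u)|‖) = fun _ => ∫ s, ‖|g' s|‖ :=
      funext fun u => integral_add_right_eq_self (fun s => ‖|g' s|‖) u
    simp only [this]
    exact integrable_const _
  exact this.integral_prod_left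

lemma integral_Icc_abs_le {g' : ℝ → ℝ} (hg' : Integrable g') (s : ℝ) :
    ∫ u in Set.Icc (-1 : ℝ) 1, |g' (s + u)| ≤ ∫ u, |g' u| := by
  refine (setIntegral_le_integral (hg'.comp_add_left s).abs
    (ae_of_all _ fun _ => abs_nonneg _)).trans ?_
  exact (integral_add_left_eq_self (fun u => |g' u|) s).le

lemma exists_abs_le_of_integrable_deriv {g g' : ℝ → ℝ} (hg : ∀ x, HasDerivAt g (g' x) x)
    (hg'c : Continuous g') (hg' : Integrable g') : ∃ M, 0 ≤ M ∧ ∀ x, |g x| ≤ M := by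
  refine ⟨|g 0| + ∫ u, |g' u|, add_nonneg (abs_nonneg _)
    (integral_nonneg fun _ => abs_nonneg _), fun x => ?_⟩
  have hFTC : ∫ u in (0 : ℝ)..x, g' u = g x - g 0 :=
    intervalIntegral.integral_eq_sub_of_hasDerivAt (fun x _ => hg x)
      (hg'c.intervalIntegrable _ _)
  have h1 : |∫ u in (0 : ℝ)..x, g' u| ≤ ∫ u, |g' u| :=
    (intervalIntegral.norm_integral_le_integral_norm_uIoc (f := g')).trans
      (setIntegral_le_integral hg'.abs (ae_of_all _ fun _ => abs_nonneg _))
  have h3 : g x = g 0 + ∫ u in (0 : ℝ)..x, g' u := by rw [hFTC]; ring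
  rw [h3]
  exact (abs_add_le _ _).trans (by linarith)

/-! ### Fractional integrals on the half-line -/

lemma integrableOn_Ioi_div_rpow {c : ℝ} (hc0 : 0 ≤ c) (hc1 : c < 1) {φ : ℝ → ℝ}
    (hφ : Integrable φ) {M : ℝ} (hM : ∀ t, |φ t| ≤ M) :
    IntegrableOn (fun t => φ t / t ^ c) (Set.Ioi 0) := by
  have hM0 : 0 ≤ M := (abs_nonneg _).trans (hM 0)
  have hk : IntegrableOn (fun t : ℝ => t ^ (-c)) (Set.Ioc 0 1) := by
    have := intervalIntegral.intervalIntegrable_rpow' (a := 0) (b := 1) (r := -c) (by linarith)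
    rwa [intervalIntegrable_iff_integrableOn_Ioc_of_le zero_le_one] at this
  have hmeas : AEStronglyMeasurable (fun t => φ t / t ^ c) volume :=
    (hφ.aestronglyMeasurable.aemeasurable.div
      (measurable_id.pow_const c).aemeasurable).aestronglyMeasurable
  rw [← Set.Ioc_union_Ioi_eq_Ioi zero_le_one]
  refine IntegrableOn.union ?_ ?_
  · refine (hk.const_mul M).mono' hmeas.restrict ?_
    filter_upwards [ae_restrict_mem measurableSet_Ioc] with t ht
    rw [Real.norm_eq_abs, abs_div, abs_of_nonneg (Real.rpow_nonneg ht.1.le c), div_eq_mul_inv,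
      ← Real.rpow_neg ht.1.le]
    exact mul_le_mul_of_nonneg_right (hM t) (Real.rpow_nonneg ht.1.le _)
  · refine hφ.abs.integrableOn.mono' hmeas.restrict ?_
    filter_upwards [ae_restrict_mem measurableSet_Ioi] with t ht
    have h1 : 1 ≤ t ^ c := Real.one_le_rpow (le_of_lt ht) hc0
    rw [Real.norm_eq_abs, abs_div, abs_of_pos (by linarith : 0 < t ^ c)]
    exact div_le_self (abs_nonneg _) h1

/-- The unnormalised left-sided fractional integral `∫_0^∞ g(x - t) t^(-c) dt`, of order
`1 - c`. -/
noncomputable def leftFracIntegral (c : ℝ) (g : ℝ → ℝ) (x : ℝ) : ℝ :=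
  ∫ t in Set.Ioi (0 : ℝ), g (x - t) / t ^ c

lemma integrableOn_comp_sub_div_rpow {c : ℝ} (hc0 : 0 ≤ c) (hc1 : c < 1) {g g' : ℝ → ℝ}
    (hg : ∀ x, HasDerivAt g (g' x) x) (hgi : Integrable g) (hg'c : Continuous g')
    (hg' : Integrable g') (x : ℝ) :
    IntegrableOn (fun t => g (x - t) / t ^ c) (Set.Ioi 0) := by
  obtain ⟨M, -, hM⟩ := exists_abs_le_of_integrable_deriv hg hg'c hg'
  exact integrableOn_Ioi_div_rpow hc0 hc1 (hgi.comp_sub_left x) fun t => hM _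

/-- Differentiation under the integral sign; near `x` the derivative of the integrand is dominated
by `(|g'(x - t)| + ∫_{-1}^1 |g''(x - t + u)| du) t^(-c)`. -/
lemma hasDerivAt_leftFracIntegral {c : ℝ} (hc0 : 0 ≤ c) (hc1 : c < 1) {g g' g'' : ℝ → ℝ}
    (hg : ∀ x, HasDerivAt g (g' x) x) (hg' : ∀ x, HasDerivAt g' (g'' x) x)
    (hg''c : Continuous g'') (hgi : Integrable g) (hg'i : Integrable g') (hg''i : Integrable g'')
    (x : ℝ) : HasDerivAt (leftFracIntegral c g) (leftFracIntegral c g' x) x := by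
  have hg'c : Continuous g' := continuous_iff_continuousAt.2 fun x => (hg' x).continuousAt
  have hgc : Continuous g := continuous_iff_continuousAt.2 fun x => (hg x).continuousAt
  set B : ℝ → ℝ := fun s => |g' s| + ∫ u in Set.Icc (-1 : ℝ) 1, |g'' (s + u)| with hB
  have hBi : Integrable B := hg'i.abs.add (integrable_integral_Icc_abs hg''c hg''i)
  obtain ⟨M, -, hM⟩ := exists_abs_le_of_integrable_deriv hg' hg''c hg''i
  have hI0 : ∀ s, 0 ≤ ∫ u in Set.Icc (-1 : ℝ) 1, |g'' (s + u)| :=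
    fun s => integral_nonneg fun _ => abs_nonneg _
  have hBM : ∀ s, |B s| ≤ M + ∫ u, |g'' u| := by
    intro s
    rw [hB, abs_of_nonneg (add_nonneg (abs_nonneg _) (hI0 s))]
    exact add_le_add (hM s) (integral_Icc_abs_le hg''i s)
  have hmeas : ∀ {φ : ℝ → ℝ}, Continuous φ → ∀ y : ℝ,
      AEStronglyMeasurable (fun t => φ (y - t) / t ^ c) (volume.restrict (Set.Ioi 0)) := by
    intro φ hφ y
    exact ((hφ.comp (continuous_const.sub continuous_id)).measurable.div
      (measurable_id.pow_const c)).aestronglyMeasurable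
  refine (hasDerivAt_integral_of_dominated_loc_of_deriv_le
    (F := fun y t => g (y - t) / t ^ c) (F' := fun y t => g' (y - t) / t ^ c)
    (bound := fun t => B (x - t) / t ^ c) (Metric.ball_mem_nhds x one_pos)
    (Eventually.of_forall fun y => hmeas hgc y)
    (integrableOn_comp_sub_div_rpow hc0 hc1 hg hgi hg'c hg'i x) (hmeas hg'c x) ?_
    (integrableOn_Ioi_div_rpow hc0 hc1 (hBi.comp_sub_left x) fun t => hBM _) ?_).2
  · filter_upwards [ae_restrict_mem measurableSet_Ioi] with t ht y hy
    have ht' : 0 < t := ht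
    rw [Real.norm_eq_abs, abs_div, abs_of_pos (Real.rpow_pos_of_pos ht' c)]
    refine div_le_div_of_nonneg_right ?_ (Real.rpow_pos_of_pos ht' c).le
    refine abs_le_add_integral_of_abs_sub_le hg' hg''c ?_
    rw [sub_sub_sub_cancel_right]
    exact (Metric.mem_ball.1 hy).le
  · filter_upwards with t y _
    exact ((hg (y - t)).comp_sub_const y t).div_const _

/-! ### Existence of the one-sided derivatives -/

section

variable {γ : ℝ} {f : ℝ → ℝ}

lemma indicator_Iio_sub (φ : ℝ → ℝ) (x t : ℝ) :
    (Set.Iio x).indicator φ (x - t) = (Set.Ioi 0).indicator (fun t => φ (x - t)) t := by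
  by_cases h : 0 < t <;> simp [Set.indicator, h]

lemma integrableOn_Iio_iff (φ : ℝ → ℝ) (x : ℝ) :
    IntegrableOn φ (Set.Iio x) ↔ IntegrableOn (fun t => φ (x - t)) (Set.Ioi 0) := by
  rw [← integrable_indicator_iff measurableSet_Iio, ← integrable_indicator_iff measurableSet_Ioi,
    ← integrable_comp_sub_left _ x]
  simp only [indicator_Iio_sub]

lemma setIntegral_Iio_eq (φ : ℝ → ℝ) (x : ℝ) :
    ∫ ξ in Set.Iio x, φ ξ = ∫ t in Set.Ioi 0, φ (x - t) := by
  rw [← integral_indicator measurableSet_Iio, ← integral_indicator measurableSet_Ioi,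
    ← integral_sub_left_eq_self _ _ x]
  simp only [indicator_Iio_sub]

lemma indicator_Ioi_neg (φ : ℝ → ℝ) (x ξ : ℝ) :
    (Set.Ioi x).indicator φ (-ξ) = (Set.Iio (-x)).indicator (fun ξ => φ (-ξ)) ξ := by
  by_cases h : x < -ξ
  · simp [Set.indicator, h, lt_neg.1 h]
  · simp [Set.indicator, h, mt lt_neg.2 h]

lemma integrableOn_Ioi_iff_comp_neg (φ : ℝ → ℝ) (x : ℝ) :
    IntegrableOn φ (Set.Ioi x) ↔ IntegrableOn (fun ξ => φ (-ξ)) (Set.Iio (-x)) := by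
  rw [← integrable_indicator_iff measurableSet_Iio, ← integrable_indicator_iff measurableSet_Ioi,
    ← integrable_comp_sub_left _ 0]
  simp only [zero_sub, indicator_Ioi_neg]

lemma setIntegral_Ioi_eq_comp_neg (φ : ℝ → ℝ) (x : ℝ) :
    ∫ ξ in Set.Ioi x, φ ξ = ∫ ξ in Set.Iio (-x), φ (-ξ) := by
  rw [← integral_indicator measurableSet_Iio, ← integral_indicator measurableSet_Ioi,
    ← integral_sub_left_eq_self _ _ 0]
  simp only [zero_sub, indicator_Ioi_neg]

lemma leftRLIntegral_eq_leftFracIntegral (γ : ℝ) (f : ℝ → ℝ) :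
    leftRLIntegral γ f = leftFracIntegral (γ - rlOrder γ + 1) f := by
  funext x
  rw [leftRLIntegral, setIntegral_Iio_eq]
  simp only [sub_sub_cancel]
  rfl

/-- Reflection in the origin exchanges the left- and right-sided integrals. -/
lemma rightRLIntegral_eq_leftRLIntegral_comp_neg (γ : ℝ) (f : ℝ → ℝ) :
    rightRLIntegral γ f = fun x => leftRLIntegral γ (fun y => f (-y)) (-x) := by
  funext x
  rw [rightRLIntegral, setIntegral_Ioi_eq_comp_neg, leftRLIntegral]
  simp only [sub_eq_add_neg, add_comm]

lemma rightRLDeriv_eq_leftRLDeriv_comp_neg (γ : ℝ) (f : ℝ → ℝ) (x : ℝ) :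
    rightRLDeriv γ f x = leftRLDeriv γ (fun y => f (-y)) (-x) := by
  rw [rightRLDeriv, leftRLDeriv, rightRLIntegral_eq_leftRLIntegral_comp_neg,
    iteratedDeriv_comp_neg, smul_eq_mul, div_mul_eq_mul_div, ← mul_assoc, ← mul_pow]
  norm_num
  ring

lemma rlOrder_exponent_nonneg (hγ : 0 ≤ γ) : 0 ≤ γ - rlOrder γ + 1 := by
  have := Nat.floor_le hγ
  unfold rlOrder
  push_cast
  linarith

lemma rlOrder_exponent_lt_one (γ : ℝ) : γ - rlOrder γ + 1 < 1 := by
  have := Nat.lt_floor_add_one γ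
  unfold rlOrder
  push_cast
  linarith

lemma hasDerivAt_leftFracIntegral_iteratedDeriv {N : ℕ} (hf : HasIntegrableDerivs N f) {c : ℝ}
    (hc0 : 0 ≤ c) (hc1 : c < 1) {j : ℕ} (hj : j + 2 ≤ N) (x : ℝ) :
    HasDerivAt (leftFracIntegral c (iteratedDeriv j f))
      (leftFracIntegral c (iteratedDeriv (j + 1) f) x) x :=
  hasDerivAt_leftFracIntegral hc0 hc1 (hf.hasDerivAt_iteratedDeriv (by omega))
    (hf.hasDerivAt_iteratedDeriv (by omega)) (hf.continuous_iteratedDeriv hj)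
    (hf.integrable _ (by omega)) (hf.integrable _ (by omega)) (hf.integrable _ hj) x

lemma iteratedDeriv_leftFracIntegral {N : ℕ} (hf : HasIntegrableDerivs N f) {c : ℝ}
    (hc0 : 0 ≤ c) (hc1 : c < 1) {j : ℕ} (hj : j + 1 ≤ N) :
    iteratedDeriv j (leftFracIntegral c f) = leftFracIntegral c (iteratedDeriv j f) := by
  induction j with
  | zero => simp
  | succ j ih =>
    rw [iteratedDeriv_succ, ih (by omega)]
    funext x
    exact (hasDerivAt_leftFracIntegral_iteratedDeriv hf hc0 hc1 hj x).deriv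

lemma contDiff_leftRLIntegral {N : ℕ} (hf : HasIntegrableDerivs N f) (hγ : 0 ≤ γ)
    (hN : rlOrder γ + 2 ≤ N) : ContDiff ℝ (rlOrder γ) (leftRLIntegral γ f) := by
  have h0 := rlOrder_exponent_nonneg hγ
  have h1 := rlOrder_exponent_lt_one γ
  rw [leftRLIntegral_eq_leftFracIntegral]
  refine contDiff_of_differentiable_iteratedDeriv (n := ((rlOrder γ : ℕ) : ℕ∞)) fun m hm x => ?_
  have hm' : m ≤ rlOrder γ := by exact_mod_cast hm
  rw [iteratedDeriv_leftFracIntegral hf h0 h1 (by omega)]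
  exact (hasDerivAt_leftFracIntegral_iteratedDeriv hf h0 h1 (by omega) x).differentiableAt

lemma leftRLDeriv_eq {N : ℕ} (hf : HasIntegrableDerivs N f) (hγ : 0 ≤ γ)
    (hN : rlOrder γ + 1 ≤ N) (x : ℝ) :
    leftRLDeriv γ f x = 1 / Real.Gamma (rlOrder γ - γ) *
      leftFracIntegral (γ - rlOrder γ + 1) (iteratedDeriv (rlOrder γ) f) x := by
  rw [leftRLDeriv, leftRLIntegral_eq_leftFracIntegral,
    iteratedDeriv_leftFracIntegral hf (rlOrder_exponent_nonneg hγ) (rlOrder_exponent_lt_one γ) hN]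

lemma integrableOn_left {N : ℕ} (hf : HasIntegrableDerivs N f) (hN : 1 ≤ N) (hγ : 0 ≤ γ) (x : ℝ) :
    IntegrableOn (fun ξ : ℝ => f ξ / (x - ξ) ^ (γ - (rlOrder γ : ℝ) + 1)) (Set.Iio x) := by
  rw [integrableOn_Iio_iff]
  simp only [sub_sub_cancel]
  have h := hf.hasDerivAt_iteratedDeriv (j := 0) (by omega)
  have hi := hf.integrable 0 (by omega)
  rw [iteratedDeriv_zero] at h hi
  exact integrableOn_comp_sub_div_rpow (rlOrder_exponent_nonneg hγ) (rlOrder_exponent_lt_one γ)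
    h hi (hf.continuous_iteratedDeriv hN) (hf.integrable _ hN) x

/-- Existence of the Riesz derivative. -/
lemma HasIntegrableDerivs.rieszDifferentiable {N : ℕ} (hf : HasIntegrableDerivs N f) (hγ : 0 ≤ γ)
    (hN : rlOrder γ + 2 ≤ N) : RieszDifferentiable γ f where
  left_integrable := integrableOn_left hf (by omega) hγ
  right_integrable x := by
    rw [integrableOn_Ioi_iff_comp_neg]
    have := integrableOn_left hf.comp_neg (by omega) hγ (-x)
    simpa only [sub_eq_add_neg, add_comm] using this
  left_contDiff := contDiff_leftRLIntegral hf hγ hN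
  right_contDiff := by
    rw [rightRLIntegral_eq_leftRLIntegral_comp_neg]
    exact (contDiff_leftRLIntegral hf.comp_neg hγ hN).comp contDiff_neg

end

/-! ### The Gamma integral with a complex rate -/

lemma integrableOn_rpow_mul_exp_neg_mul {s b : ℝ} (hs : -1 < s) (hb : 0 < b) :
    IntegrableOn (fun t : ℝ => t ^ s * Real.exp (-(b * t))) (Set.Ioi 0) := by
  have := integrableOn_rpow_mul_exp_neg_mul_rpow hs one_pos hb
  simpa only [Real.rpow_one, neg_mul] using this

lemma norm_ofReal_mul_cexp_neg_mul (p t : ℝ) (r : ℂ) :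
    ‖(p : ℂ) * Complex.exp (-(r * t))‖ = |p| * Real.exp (-(r.re * t)) := by
  rw [norm_mul, Complex.norm_real, Real.norm_eq_abs, Complex.norm_exp, Complex.neg_re,
    Complex.re_mul_ofReal]

lemma integrableOn_rpow_mul_cexp_neg_mul {s : ℝ} (hs : -1 < s) {r : ℂ} (hr : 0 < r.re) :
    IntegrableOn (fun t : ℝ => ((t ^ s : ℝ) : ℂ) * Complex.exp (-(r * t))) (Set.Ioi 0) := by
  refine (integrableOn_rpow_mul_exp_neg_mul hs hr).mono' (by fun_prop) ?_
  filter_upwards [ae_restrict_mem measurableSet_Ioi] with t ht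
  rw [norm_ofReal_mul_cexp_neg_mul, abs_of_nonneg (Real.rpow_nonneg (le_of_lt ht) _)]

/-- Both sides are holomorphic in `r` on the right half-plane and agree for real `r`. -/
lemma integral_rpow_mul_cexp_neg_mul_Ioi {a : ℝ} (ha : 0 < a) {r : ℂ} (hr : 0 < r.re) :
    ∫ t in Set.Ioi (0 : ℝ), ((t ^ (a - 1) : ℝ) : ℂ) * Complex.exp (-(r * t)) =
      Real.Gamma a * r ^ (-(a : ℂ)) := by
  set U : Set ℂ := {z | 0 < z.re} with hU
  have hUo : IsOpen U := isOpen_lt continuous_const Complex.continuous_re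
  have hUc : IsPreconnected U := (convex_halfSpace_re_gt 0).isPreconnected
  set J : ℂ → ℂ := fun r => ∫ t in Set.Ioi (0 : ℝ),
    ((t ^ (a - 1) : ℝ) : ℂ) * Complex.exp (-(r * t)) with hJ
  have hJd : DifferentiableOn ℂ J U := by
    intro z hz
    have hz' : 0 < z.re / 2 := half_pos hz
    refine DifferentiableAt.differentiableWithinAt (HasDerivAt.differentiableAt
      (f' := ∫ t in Set.Ioi (0 : ℝ),
        ((t ^ (a - 1) : ℝ) : ℂ) * (Complex.exp (-(z * t)) * -(1 * t))) ?_)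
    refine (hasDerivAt_integral_of_dominated_loc_of_deriv_le
      (F := fun r (t : ℝ) => ((t ^ (a - 1) : ℝ) : ℂ) * Complex.exp (-(r * t)))
      (F' := fun r (t : ℝ) => ((t ^ (a - 1) : ℝ) : ℂ) * (Complex.exp (-(r * t)) * -(1 * t)))
      (bound := fun t => t ^ a * Real.exp (-(z.re / 2 * t))) (Metric.ball_mem_nhds z hz')
      (Eventually.of_forall fun y => by fun_prop)
      (integrableOn_rpow_mul_cexp_neg_mul (by linarith) hz) (by fun_prop) ?_
      (integrableOn_rpow_mul_exp_neg_mul (by linarith) hz') ?_).2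
    · filter_upwards [ae_restrict_mem measurableSet_Ioi] with t ht y hy
      have ht' : 0 < t := ht
      have hre : z.re / 2 ≤ y.re := by
        have h1 := Complex.abs_re_le_norm (y - z)
        rw [← dist_eq_norm] at h1
        have h2 := (abs_le.1 (h1.trans (Metric.mem_ball.1 hy).le)).1
        rw [Complex.sub_re] at h2
        linarith
      rw [← mul_assoc, norm_mul, norm_ofReal_mul_cexp_neg_mul, norm_neg, one_mul,
        Complex.norm_real, Real.norm_eq_abs, abs_of_pos ht', abs_of_pos (by positivity),
        mul_right_comm, ← Real.rpow_add_one ht'.ne', sub_add_cancel]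
      gcongr
    · filter_upwards with t y _
      exact (((hasDerivAt_id y).mul_const (t : ℂ)).neg.cexp).const_mul _
  have hRd : DifferentiableOn ℂ (fun r : ℂ => (Real.Gamma a : ℂ) * r ^ (-(a : ℂ))) U := by
    intro z hz
    exact ((differentiableAt_id.cpow_const (Or.inl hz)).const_mul _).differentiableWithinAt
  refine (hJd.analyticOnNhd hUo).eqOn_of_preconnected_of_frequently_eq (hRd.analyticOnNhd hUo)
    hUc (z₀ := 1) (by simp [hU]) ?_ hr
  have htend : Tendsto (fun x : ℝ => (x : ℂ)) (𝓝[≠] 1) (𝓝[≠] 1) := by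
    refine tendsto_nhdsWithin_iff.2 ⟨?_, ?_⟩
    · have := (Complex.continuous_ofReal.tendsto (1 : ℝ)).mono_left
        (nhdsWithin_le_nhds (s := {1}ᶜ))
      simpa using this
    · filter_upwards [self_mem_nhdsWithin] with x hx
      simpa using hx
  refine htend.frequently (Eventually.frequently ?_)
  have hpos : ∀ᶠ x : ℝ in 𝓝[≠] 1, 0 < x :=
    nhdsWithin_le_nhds (lt_mem_nhds one_pos)
  filter_upwards [hpos] with x hx
  have h := Complex.integral_cpow_mul_exp_neg_mul_Ioi (a := (a : ℂ)) (r := x) (by simpa using ha) hx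
  rw [Complex.Gamma_ofReal, one_div, Complex.inv_cpow _ _ (by
    rw [Complex.arg_ofReal_of_nonneg hx.le]; exact Real.pi_pos.ne), ← Complex.cpow_neg,
    mul_comm] at h
  rw [← h]
  refine setIntegral_congr_fun measurableSet_Ioi fun t ht => ?_
  rw [Complex.ofReal_cpow (le_of_lt ht)]
  push_cast
  rfl

/-! ### Fractional integrals of Fourier integrals -/

lemma norm_cexp_two_pi_mul_I (x ξ : ℝ) :
    ‖Complex.exp (2 * Real.pi * x * ξ * Complex.I)‖ = 1 := by
  have : (2 * Real.pi * x * ξ * Complex.I : ℂ) = ((2 * Real.pi * x * ξ : ℝ) : ℂ) * Complex.I := by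
    push_cast; ring
  rw [this, Complex.norm_exp_ofReal_mul_I]

lemma integrable_cexp_mul {G : ℝ → ℂ} (hG : Integrable G) (x : ℝ) :
    Integrable fun ξ : ℝ => Complex.exp (2 * Real.pi * x * ξ * Complex.I) * G ξ :=
  hG.bdd_mul (c := 1) (by fun_prop) (ae_of_all _ fun ξ => (norm_cexp_two_pi_mul_I x ξ).le)

/-- Abel-regularised form of `leftFracIntegral_eq_integral`. -/
lemma integral_exp_neg_mul_mul_div_rpow {c ε : ℝ} (hc1 : c < 1) (hε : 0 < ε) {g : ℝ → ℝ}
    {G : ℝ → ℂ} (hG : Integrable G)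
    (hgG : ∀ x, (g x : ℂ) = ∫ ξ : ℝ, Complex.exp (2 * Real.pi * x * ξ * Complex.I) * G ξ)
    (x : ℝ) :
    ∫ t in Set.Ioi (0 : ℝ), ((Real.exp (-(ε * t)) * (g (x - t) / t ^ c) : ℝ) : ℂ) =
      Real.Gamma (1 - c) * ∫ ξ : ℝ, Complex.exp (2 * Real.pi * x * ξ * Complex.I) *
        ((ε + 2 * Real.pi * ξ * Complex.I) ^ (-((1 - c : ℝ) : ℂ)) * G ξ) := by
  set k : ℝ → ℂ := fun t => ((t ^ (-c) : ℝ) : ℂ) * Complex.exp (-((ε : ℂ) * t)) with hk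
  have hki : IntegrableOn k (Set.Ioi 0) :=
    integrableOn_rpow_mul_cexp_neg_mul (by linarith) (by simpa using hε)
  have hprod : Integrable (Function.uncurry fun (t ξ : ℝ) =>
      Complex.exp (2 * Real.pi * (x - t) * ξ * Complex.I) * (k t * G ξ))
      ((volume.restrict (Set.Ioi (0 : ℝ))).prod volume) := by
    refine (Integrable.mul_prod hki hG).bdd_mul (c := 1) ?_ (ae_of_all _ fun p => ?_)
    · exact Continuous.aestronglyMeasurable (by fun_prop)
    · have := norm_cexp_two_pi_mul_I (x - p.1) p.2
      push_cast at this
      exact this.le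
  calc ∫ t in Set.Ioi (0 : ℝ), ((Real.exp (-(ε * t)) * (g (x - t) / t ^ c) : ℝ) : ℂ)
      = ∫ t in Set.Ioi (0 : ℝ), ∫ ξ : ℝ,
          Complex.exp (2 * Real.pi * (x - t) * ξ * Complex.I) * (k t * G ξ) := by
        refine setIntegral_congr_fun measurableSet_Ioi fun t ht => ?_
        have ht' : 0 < t := ht
        have e : ((Real.exp (-(ε * t)) * (g (x - t) / t ^ c) : ℝ) : ℂ) = k t * g (x - t) := by
          simp only [hk, Real.rpow_neg ht'.le]
          push_cast
          ring
        rw [e, hgG, ← integral_const_mul]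
        refine integral_congr_ae (ae_of_all _ fun ξ => ?_)
        simp only
        push_cast
        ring
    _ = ∫ ξ : ℝ, ∫ t in Set.Ioi (0 : ℝ),
          Complex.exp (2 * Real.pi * (x - t) * ξ * Complex.I) * (k t * G ξ) :=
        integral_integral_swap hprod
    _ = ∫ ξ : ℝ, Real.Gamma (1 - c) * (Complex.exp (2 * Real.pi * x * ξ * Complex.I) *
        ((ε + 2 * Real.pi * ξ * Complex.I) ^ (-((1 - c : ℝ) : ℂ)) * G ξ)) := by
        refine integral_congr_ae (ae_of_all _ fun ξ => ?_)
        simp only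
        have h := integral_rpow_mul_cexp_neg_mul_Ioi (a := 1 - c) (by linarith)
          (r := ε + 2 * Real.pi * ξ * Complex.I) (by simpa using hε)
        have e : ∀ t : ℝ, Complex.exp (2 * Real.pi * (x - t) * ξ * Complex.I) * (k t * G ξ) =
            (Complex.exp (2 * Real.pi * x * ξ * Complex.I) * G ξ) *
              (((t ^ (1 - c - 1) : ℝ) : ℂ) *
                Complex.exp (-((ε + 2 * Real.pi * ξ * Complex.I) * t))) := by
          intro t
          have e1 : Complex.exp (2 * Real.pi * (x - t) * ξ * Complex.I) *
              Complex.exp (-((ε : ℂ) * t)) = Complex.exp (2 * Real.pi * x * ξ * Complex.I) *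
                Complex.exp (-((ε + 2 * Real.pi * ξ * Complex.I) * t)) := by
            rw [← Complex.exp_add, ← Complex.exp_add]
            congr 1
            ring
          rw [hk, show 1 - c - 1 = -c by ring]
          linear_combination (((t ^ (-c) : ℝ) : ℂ) * G ξ) * e1
        simp only [e]
        rw [integral_const_mul, h]
        ring
    _ = _ := integral_const_mul _ _

/-- On the Fourier side the left-sided fractional integral of order `1 - c` is multiplication by
`(2πiξ)^(-(1 - c))`. -/
lemma leftFracIntegral_eq_integral {c : ℝ} (hc1 : c < 1) {g : ℝ → ℝ}
    {G : ℝ → ℂ} (hG : Integrable G)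
    (hgG : ∀ x, (g x : ℂ) = ∫ ξ : ℝ, Complex.exp (2 * Real.pi * x * ξ * Complex.I) * G ξ)
    (hG' : Integrable fun ξ : ℝ => |2 * Real.pi * ξ| ^ (-(1 - c)) * ‖G ξ‖)
    (x : ℝ) (hgi : IntegrableOn (fun t => g (x - t) / t ^ c) (Set.Ioi 0)) :
    (leftFracIntegral c g x : ℂ) =
      Real.Gamma (1 - c) * ∫ ξ : ℝ, Complex.exp (2 * Real.pi * x * ξ * Complex.I) *
        ((2 * Real.pi * ξ * Complex.I) ^ (-((1 - c : ℝ) : ℂ)) * G ξ) := by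
  have hL : Tendsto (fun ε : ℝ => ∫ t in Set.Ioi (0 : ℝ),
      ((Real.exp (-(ε * t)) * (g (x - t) / t ^ c) : ℝ) : ℂ)) (𝓝[>] 0)
      (𝓝 (leftFracIntegral c g x : ℂ)) := by
    rw [leftFracIntegral, ← integral_complex_ofReal]
    refine tendsto_integral_filter_of_dominated_convergence
      (fun t => ‖g (x - t) / t ^ c‖) ?_ ?_ hgi.norm ?_
    · refine Eventually.of_forall fun ε => ?_
      refine Complex.continuous_ofReal.comp_aestronglyMeasurable ?_
      exact (Continuous.aestronglyMeasurable (by fun_prop)).mul hgi.aestronglyMeasurable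
    · filter_upwards [self_mem_nhdsWithin] with ε hε
      filter_upwards [ae_restrict_mem measurableSet_Ioi] with t ht
      have hεt : 0 < ε * t := mul_pos hε ht
      rw [Complex.norm_real, norm_mul, Real.norm_eq_abs, Real.abs_exp]
      exact mul_le_of_le_one_left (norm_nonneg _) (Real.exp_le_one_iff.2 (by linarith))
    · refine ae_of_all _ fun t => ?_
      have : Continuous fun ε : ℝ => ((Real.exp (-(ε * t)) * (g (x - t) / t ^ c) : ℝ) : ℂ) := by
        fun_prop
      have h := (this.tendsto 0).mono_left (nhdsWithin_le_nhds (s := Set.Ioi 0))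
      simpa using h
  have hR : Tendsto (fun ε : ℝ => (Real.Gamma (1 - c) : ℂ) *
      ∫ ξ : ℝ, Complex.exp (2 * Real.pi * x * ξ * Complex.I) *
        ((ε + 2 * Real.pi * ξ * Complex.I) ^ (-((1 - c : ℝ) : ℂ)) * G ξ)) (𝓝[>] 0)
      (𝓝 (Real.Gamma (1 - c) * ∫ ξ : ℝ, Complex.exp (2 * Real.pi * x * ξ * Complex.I) *
        ((2 * Real.pi * ξ * Complex.I) ^ (-((1 - c : ℝ) : ℂ)) * G ξ))) := by
    refine Tendsto.const_mul _ ?_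
    have hne : ∀ᵐ ξ : ℝ, ξ ≠ 0 := by simp [ae_iff]
    refine tendsto_integral_filter_of_dominated_convergence
      (fun ξ => |2 * Real.pi * ξ| ^ (-(1 - c)) * ‖G ξ‖) ?_ ?_ hG' ?_
    · refine Eventually.of_forall fun ε => ?_
      have hm : Measurable fun ξ : ℝ =>
          ((ε : ℂ) + 2 * Real.pi * ξ * Complex.I) ^ (-((1 - c : ℝ) : ℂ)) := by
        fun_prop
      exact (Continuous.aestronglyMeasurable (by fun_prop)).mul
        (hm.aestronglyMeasurable.mul hG.aestronglyMeasurable)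
    · filter_upwards [self_mem_nhdsWithin] with ε hε
      filter_upwards [hne] with ξ hξ
      have hε' : (0 : ℝ) < ε := hε
      have him : |2 * Real.pi * ξ| ≤ ‖(ε : ℂ) + 2 * Real.pi * ξ * Complex.I‖ := by
        have := Complex.abs_im_le_norm ((ε : ℂ) + 2 * Real.pi * ξ * Complex.I)
        simpa using this
      have hpos : 0 < |2 * Real.pi * ξ| := abs_pos.2 (by positivity)
      rw [norm_mul, norm_cexp_two_pi_mul_I, one_mul, norm_mul, ← Complex.ofReal_neg,
        Complex.norm_cpow_real]
      refine mul_le_mul_of_nonneg_right ?_ (norm_nonneg _)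
      exact Real.rpow_le_rpow_of_nonpos hpos him (by linarith)
    · filter_upwards [hne] with ξ hξ
      have hslit : (2 * Real.pi * ξ * Complex.I : ℂ) ∈ Complex.slitPlane := by
        right
        simp [Real.pi_ne_zero, hξ]
      have hcont : Tendsto (fun ε : ℝ => (ε : ℂ) + 2 * Real.pi * ξ * Complex.I) (𝓝[>] 0)
          (𝓝 (2 * Real.pi * ξ * Complex.I)) := by
        have : Continuous fun ε : ℝ => (ε : ℂ) + 2 * Real.pi * ξ * Complex.I := by fun_prop
        have h := (this.tendsto 0).mono_left (nhdsWithin_le_nhds (s := Set.Ioi 0))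
        simpa using h
      have := (continuousAt_cpow_const (b := (-((1 - c : ℝ) : ℂ))) hslit).tendsto.comp hcont
      exact (this.mul_const _).const_mul _
  refine tendsto_nhds_unique hL (hR.congr' ?_)
  filter_upwards [self_mem_nhdsWithin] with ε hε
  exact (integral_exp_neg_mul_mul_div_rpow hc1 hε hG hgG x).symm

/-! ### The Fourier transform of a function with integrable derivatives -/

/-- The Fourier transform `∫ f(x) exp(-2πixξ) dx` of a real function. -/
noncomputable def realFourier (f : ℝ → ℝ) : ℝ → ℂ :=
  FourierTransform.fourier fun x => (f x : ℂ)

lemma realFourier_comp_neg (f : ℝ → ℝ) (ξ : ℝ) :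
    realFourier (fun x => f (-x)) ξ = realFourier f (-ξ) := by
  simp only [realFourier, Real.fourier_real_eq_integral_exp_smul]
  rw [← integral_neg_eq_self]
  simp

section

variable {N : ℕ} {f : ℝ → ℝ}

lemma HasIntegrableDerivs.iteratedDeriv_ofReal (hf : HasIntegrableDerivs N f) {j : ℕ}
    (hj : j ≤ N) : iteratedDeriv j (fun x => (f x : ℂ)) = fun x => ((iteratedDeriv j f x : ℝ) : ℂ) := by
  induction j with
  | zero => simp
  | succ j ih =>
    rw [iteratedDeriv_succ, ih (by omega)]
    funext x
    exact ((hf.hasDerivAt_iteratedDeriv (by omega) x).ofReal_comp).deriv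

lemma HasIntegrableDerivs.realFourier_iteratedDeriv (hf : HasIntegrableDerivs N f) {j : ℕ}
    (hj : j ≤ N) : realFourier (iteratedDeriv j f) =
      fun ξ : ℝ => (2 * Real.pi * ξ * Complex.I) ^ j * realFourier f ξ := by
  have hc : ContDiff ℝ ((N : ℕ∞) : WithTop ℕ∞) fun x => (f x : ℂ) :=
    Complex.ofRealCLM.contDiff.comp hf.contDiff
  have hi : ∀ n : ℕ, (n : ℕ∞) ≤ N → Integrable (iteratedDeriv n fun x => (f x : ℂ)) := by
    intro n hn
    have hn' : n ≤ N := by exact_mod_cast hn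
    rw [hf.iteratedDeriv_ofReal hn']
    exact (hf.integrable n hn').ofReal
  have h := Real.fourier_iteratedDeriv hc hi (n := j) (by exact_mod_cast hj)
  rw [hf.iteratedDeriv_ofReal hj] at h
  rw [realFourier, h]
  funext ξ
  rw [smul_eq_mul, realFourier]
  congr 2
  ring

lemma continuous_realFourier (hf : Integrable f) : Continuous (realFourier f) :=
  VectorFourier.fourierIntegral_continuous Real.continuous_fourierChar
    (by exact continuous_inner) hf.ofReal

lemma norm_realFourier_le (f : ℝ → ℝ) (ξ : ℝ) : ‖realFourier f ξ‖ ≤ ∫ x, |f x| := by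
  refine (VectorFourier.norm_fourierIntegral_le_integral_norm _ _ _ _ ξ).trans_eq ?_
  simp

lemma norm_two_pi_mul_I (ξ : ℝ) : ‖(2 * Real.pi * ξ * Complex.I : ℂ)‖ = |2 * Real.pi * ξ| := by
  simp [abs_mul]

lemma HasIntegrableDerivs.pow_mul_norm_realFourier_le (hf : HasIntegrableDerivs N f) {j : ℕ}
    (hj : j ≤ N) (ξ : ℝ) :
    |2 * Real.pi * ξ| ^ j * ‖realFourier f ξ‖ ≤ ∫ x, |iteratedDeriv j f x| := by
  have h := norm_realFourier_le (iteratedDeriv j f) ξ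
  rwa [hf.realFourier_iteratedDeriv hj, norm_mul, norm_pow, norm_two_pi_mul_I] at h

/-- `|ξ|^s |f̂(ξ)|` is integrable for `0 ≤ s < N - 1`, since `f̂` and `ξ^N f̂` are bounded. -/
lemma HasIntegrableDerivs.integrable_rpow_mul_realFourier (hf : HasIntegrableDerivs N f) {s : ℝ}
    (hs0 : 0 ≤ s) (hs : s + 1 < N) :
    Integrable fun ξ : ℝ => |2 * Real.pi * ξ| ^ s * ‖realFourier f ξ‖ := by
  set A := ∫ x, |f x|
  set B := ∫ x, |iteratedDeriv N f x|
  have hA : 0 ≤ A := integral_nonneg fun _ => abs_nonneg _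
  have hB : 0 ≤ B := integral_nonneg fun _ => abs_nonneg _
  have hf0 : Integrable f := by simpa using hf.integrable 0 (Nat.zero_le _)
  have hint : Integrable fun ξ : ℝ => (1 + ‖2 * Real.pi * ξ‖) ^ (-(N - s)) :=
    (integrable_one_add_norm (E := ℝ) (μ := volume) (r := N - s)
      (by simp; linarith)).comp_mul_left' (by positivity)
  refine (hint.const_mul (2 ^ (N - s) * (A + B))).mono' ?_ (ae_of_all _ fun ξ => ?_)
  · exact (Continuous.mul ((by fun_prop : Continuous fun ξ : ℝ => |2 * Real.pi * ξ|).rpow_const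
      fun _ => Or.inr hs0) (continuous_realFourier hf0).norm).aestronglyMeasurable
  · have hF0 := norm_realFourier_le f ξ
    have hFN := hf.pow_mul_norm_realFourier_le le_rfl ξ
    rw [Real.norm_eq_abs, abs_of_nonneg (by positivity), Real.norm_eq_abs]
    set z := |2 * Real.pi * ξ|
    have hz : 0 ≤ z := abs_nonneg _
    have hpos : 0 < (1 + z) ^ (N - s) := by positivity
    rw [Real.rpow_neg (by positivity), ← div_eq_mul_inv, le_div_iff₀ hpos]
    rcases le_or_gt z 1 with h1 | h1
    · have e1 : z ^ s ≤ 1 := Real.rpow_le_one hz h1 hs0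
      have e2 : (1 + z) ^ (N - s) ≤ 2 ^ (N - s) :=
        Real.rpow_le_rpow (by positivity) (by linarith) (by linarith)
      calc z ^ s * ‖realFourier f ξ‖ * (1 + z) ^ (N - s)
          ≤ 1 * (A + B) * 2 ^ (N - s) := by
            gcongr
            exact hF0.trans (by linarith)
        _ = _ := by ring
    · have e2 : (1 + z) ^ (N - s) ≤ (2 * z) ^ (N - s) :=
        Real.rpow_le_rpow (by positivity) (by linarith) (by linarith)
      have e3 : z ^ s * z ^ (N - s) = z ^ N := by
        rw [← Real.rpow_add (by linarith), add_sub_cancel, Real.rpow_natCast]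
      calc z ^ s * ‖realFourier f ξ‖ * (1 + z) ^ (N - s)
          ≤ z ^ s * ‖realFourier f ξ‖ * (2 * z) ^ (N - s) := by gcongr
        _ = 2 ^ (N - s) * ((z ^ s * z ^ (N - s)) * ‖realFourier f ξ‖) := by
            rw [Real.mul_rpow (by norm_num) hz]; ring
        _ ≤ 2 ^ (N - s) * (A + B) := by
            rw [e3]
            gcongr
            linarith

lemma HasIntegrableDerivs.integrable_realFourier (hf : HasIntegrableDerivs N f) (hN : 2 ≤ N) :
    Integrable (realFourier f) := by
  have hf0 : Integrable f := by simpa using hf.integrable 0 (Nat.zero_le _)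
  have hN' : (2 : ℝ) ≤ N := by exact_mod_cast hN
  have h := hf.integrable_rpow_mul_realFourier le_rfl (by linarith)
  simp only [Real.rpow_zero, one_mul] at h
  exact (integrable_norm_iff (continuous_realFourier hf0).aestronglyMeasurable).1 h

lemma HasIntegrableDerivs.integrable_pow_mul_realFourier (hf : HasIntegrableDerivs N f) {j : ℕ}
    (hj : j + 2 ≤ N) :
    Integrable fun ξ : ℝ => (2 * Real.pi * ξ * Complex.I) ^ j * realFourier f ξ := by
  have hf0 : Integrable f := by simpa using hf.integrable 0 (Nat.zero_le _)
  have hN' : (j : ℝ) + 2 ≤ N := by exact_mod_cast hj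
  have h := hf.integrable_rpow_mul_realFourier (s := j) (by positivity) (by linarith)
  refine (integrable_norm_iff ?_).1 ?_
  · have := continuous_realFourier hf0
    exact Continuous.aestronglyMeasurable (by fun_prop)
  · refine h.congr (ae_of_all _ fun ξ => ?_)
    simp only
    rw [norm_mul, norm_pow, norm_two_pi_mul_I, Real.rpow_natCast]

/-- Fourier inversion for the derivatives of `f`. -/
lemma HasIntegrableDerivs.iteratedDeriv_eq_integral (hf : HasIntegrableDerivs N f) {j : ℕ}
    (hj : j + 2 ≤ N) (x : ℝ) :
    ((iteratedDeriv j f x : ℝ) : ℂ) = ∫ ξ : ℝ, Complex.exp (2 * Real.pi * x * ξ * Complex.I) *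
      ((2 * Real.pi * ξ * Complex.I) ^ j * realFourier f ξ) := by
  have hF := hf.realFourier_iteratedDeriv (j := j) (by omega)
  have hi := hf.integrable_pow_mul_realFourier hj
  rw [← hF] at hi
  have hc : Continuous fun x => ((iteratedDeriv j f x : ℝ) : ℂ) :=
    Complex.continuous_ofReal.comp (hf.continuous_iteratedDeriv (by omega))
  have h := congrFun (hc.fourierInv_fourier_eq (hf.integrable j (by omega)).ofReal hi) x
  rw [← h, Real.fourierInv_eq']
  refine integral_congr_ae (ae_of_all _ fun ξ => ?_)
  simp only
  have hF' := congrFun hF ξ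
  rw [realFourier] at hF'
  rw [hF', smul_eq_mul]
  congr 2
  simp
  ring

/-! ### The Riesz derivative as a Fourier multiplier -/

lemma HasIntegrableDerivs.leftRLDeriv_eq_integral (hf : HasIntegrableDerivs N f) {γ : ℝ}
    (hγ : 0 < γ) (hγ' : γ ≠ ⌊γ⌋₊) (hN : rlOrder γ + 2 ≤ N) (x : ℝ) :
    (leftRLDeriv γ f x : ℂ) = ∫ ξ : ℝ, Complex.exp (2 * Real.pi * x * ξ * Complex.I) *
      ((2 * Real.pi * ξ * Complex.I) ^ (γ : ℂ) * realFourier f ξ) := by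
  set n := rlOrder γ with hn
  have hfl : (⌊γ⌋₊ : ℝ) ≤ γ := Nat.floor_le hγ.le
  have hfl' : (⌊γ⌋₊ : ℝ) < γ := lt_of_le_of_ne hfl (Ne.symm hγ')
  have hc0 := rlOrder_exponent_nonneg hγ.le
  have hc1 := rlOrder_exponent_lt_one γ
  have hnγ : 0 < (n : ℝ) - γ := by linarith
  have hG := hf.integrable_pow_mul_realFourier hN
  have hNr : (n : ℝ) + 2 ≤ N := by exact_mod_cast hN
  have hne : ∀ᵐ ξ : ℝ, ξ ≠ 0 := by simp [ae_iff]
  have ha : 1 - (γ - n + 1) = n - γ := by ring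
  have hcast : ∀ ξ : ℝ, ξ ≠ 0 → (2 * Real.pi * ξ * Complex.I : ℂ) ≠ 0 := fun ξ hξ => by
    simp [Real.pi_ne_zero, hξ]
  have hG' : Integrable fun ξ : ℝ => |2 * Real.pi * ξ| ^ (-(1 - (γ - n + 1))) *
      ‖(2 * Real.pi * ξ * Complex.I) ^ n * realFourier f ξ‖ := by
    refine (hf.integrable_rpow_mul_realFourier hγ.le (by linarith)).congr ?_
    filter_upwards [hne] with ξ hξ
    have hpos : 0 < |2 * Real.pi * ξ| := abs_pos.2 (by positivity)
    rw [norm_mul, norm_pow, norm_two_pi_mul_I, ← mul_assoc, ← Real.rpow_natCast,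
      ← Real.rpow_add hpos, ha]
    congr 2
    ring
  have hgi := integrableOn_comp_sub_div_rpow hc0 hc1
    (hf.hasDerivAt_iteratedDeriv (j := n) (by omega)) (hf.integrable n (by omega))
    (hf.continuous_iteratedDeriv (by omega)) (hf.integrable _ (by omega)) x
  have h := leftFracIntegral_eq_integral hc1 hG (hf.iteratedDeriv_eq_integral hN) hG' x hgi
  rw [leftRLDeriv_eq hf hγ.le (by omega), Complex.ofReal_mul, h, ha]
  have hΓ : (Real.Gamma (n - γ) : ℂ) ≠ 0 := by
    exact_mod_cast (Real.Gamma_pos_of_pos hnγ).ne'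
  rw [Complex.ofReal_div, Complex.ofReal_one, ← mul_assoc, one_div, inv_mul_cancel₀ hΓ, one_mul]
  refine integral_congr_ae ?_
  filter_upwards [hne] with ξ hξ
  rw [← mul_assoc ((2 * Real.pi * ξ * Complex.I : ℂ) ^ (-((n - γ : ℝ) : ℂ))), ← Complex.cpow_natCast,
    ← Complex.cpow_add _ _ (hcast ξ hξ)]
  congr 3
  push_cast
  ring

lemma HasIntegrableDerivs.rightRLDeriv_eq_integral (hf : HasIntegrableDerivs N f) {γ : ℝ}
    (hγ : 0 < γ) (hγ' : γ ≠ ⌊γ⌋₊) (hN : rlOrder γ + 2 ≤ N) (x : ℝ) :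
    (rightRLDeriv γ f x : ℂ) = ∫ ξ : ℝ, Complex.exp (2 * Real.pi * x * ξ * Complex.I) *
      ((-(2 * Real.pi * ξ * Complex.I)) ^ (γ : ℂ) * realFourier f ξ) := by
  rw [rightRLDeriv_eq_leftRLDeriv_comp_neg, hf.comp_neg.leftRLDeriv_eq_integral hγ hγ' hN,
    ← integral_neg_eq_self]
  simp [realFourier_comp_neg]

lemma cpow_mul_I_add_cpow_neg_mul_I {γ : ℝ} (hγ : 0 < γ) (y : ℝ) :
    ((y : ℂ) * Complex.I) ^ (γ : ℂ) + (-((y : ℂ) * Complex.I)) ^ (γ : ℂ) =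
      2 * Real.cos (Real.pi * γ / 2) * ((|y| ^ γ : ℝ) : ℂ) := by
  wlog hy : 0 ≤ y generalizing y
  · have := this (-y) (by linarith)
    rw [abs_neg] at this
    rw [← this, add_comm]
    push_cast
    simp
  have hI : Complex.I ^ (γ : ℂ) = Complex.exp ((Real.pi * γ / 2 : ℝ) * Complex.I) := by
    rw [Complex.cpow_def_of_ne_zero Complex.I_ne_zero, Complex.log_I]
    congr 1
    push_cast
    ring
  have hI' : (-Complex.I) ^ (γ : ℂ) = Complex.exp (-((Real.pi * γ / 2 : ℝ) * Complex.I)) := by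
    rw [Complex.cpow_def_of_ne_zero (neg_ne_zero.2 Complex.I_ne_zero), Complex.log_neg_I]
    congr 1
    push_cast
    ring
  rw [← mul_neg, abs_of_nonneg hy, Complex.ofReal_cos, Complex.cos]
  rcases hy.eq_or_lt with rfl | hpos
  · simp [Real.zero_rpow hγ.ne', Complex.zero_cpow, hγ.ne']
  · have hm : ∀ z : ℂ, z ≠ 0 → ((y : ℂ) * z) ^ (γ : ℂ) = (y : ℂ) ^ (γ : ℂ) * z ^ (γ : ℂ) := by
      intro z hz
      rw [Complex.cpow_def_of_ne_zero (mul_ne_zero (by exact_mod_cast hpos.ne') hz),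
        Complex.log_ofReal_mul hpos hz, add_mul, Complex.exp_add,
        Complex.cpow_def_of_ne_zero (by exact_mod_cast hpos.ne'), Complex.cpow_def_of_ne_zero hz,
        Complex.ofReal_log hpos.le]
    rw [hm _ Complex.I_ne_zero, hm _ (neg_ne_zero.2 Complex.I_ne_zero), hI, hI',
      Complex.ofReal_cpow hpos.le, neg_mul]
    ring

lemma cos_pi_mul_div_two_ne_zero {γ : ℝ} (h0 : 0 < γ) (h2 : γ < 2) (h1 : γ ≠ 1) :
    Real.cos (Real.pi * γ / 2) ≠ 0 := by
  have hpi := Real.pi_pos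
  rcases lt_or_gt_of_ne h1 with h | h
  · exact (Real.cos_pos_of_mem_Ioo ⟨by nlinarith, by nlinarith⟩).ne'
  · exact (Real.cos_neg_of_pi_div_two_lt_of_lt (by nlinarith) (by nlinarith)).ne

lemma ne_floor {γ : ℝ} (h0 : 0 < γ) (h2 : γ < 2) (h1 : γ ≠ 1) : γ ≠ ⌊γ⌋₊ := by
  intro h
  have a : (0 : ℝ) < ⌊γ⌋₊ := h ▸ h0
  have b : ((⌊γ⌋₊ : ℕ) : ℝ) < 2 := h ▸ h2
  have a' : 0 < ⌊γ⌋₊ := by exact_mod_cast a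
  have b' : ⌊γ⌋₊ < 2 := by exact_mod_cast b
  have c : ⌊γ⌋₊ = 1 := by omega
  rw [c] at h
  exact h1 (by simpa using h)

lemma rlOrder_le {γ : ℝ} (h2 : γ ≤ 2) : rlOrder γ ≤ 3 := by
  have : ⌊γ⌋₊ ≤ 2 := Nat.floor_le_of_le (by exact_mod_cast h2)
  unfold rlOrder
  omega

/-- The Riesz derivative is the Fourier multiplier with symbol `-|2πξ|^γ`. -/
lemma HasIntegrableDerivs.rieszDeriv_eq_integral (hf : HasIntegrableDerivs N f) {γ : ℝ}
    (h0 : 0 < γ) (h2 : γ < 2) (h1 : γ ≠ 1) (hN : 5 ≤ N) (x : ℝ) :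
    (rieszDeriv γ f x : ℂ) = -∫ ξ : ℝ, Complex.exp (2 * Real.pi * x * ξ * Complex.I) *
      (((|2 * Real.pi * ξ| ^ γ : ℝ) : ℂ) * realFourier f ξ) := by
  have hn : rlOrder γ + 2 ≤ N := by have := rlOrder_le h2.le; omega
  have hfl := ne_floor h0 h2 h1
  have hNr : (5 : ℝ) ≤ N := by exact_mod_cast hN
  have hf0 : Integrable f := by simpa using hf.integrable 0 (Nat.zero_le _)
  have hFm := (continuous_realFourier hf0).aestronglyMeasurable (μ := volume)
  have hint : ∀ w : ℝ → ℂ, Measurable w → (∀ ξ : ℝ, ‖w ξ‖ = |2 * Real.pi * ξ|) →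
      Integrable fun ξ : ℝ => Complex.exp (2 * Real.pi * x * ξ * Complex.I) *
        (w ξ ^ (γ : ℂ) * realFourier f ξ) := by
    intro w hw hwn
    refine integrable_cexp_mul ?_ x
    refine (hf.integrable_rpow_mul_realFourier h0.le (by linarith)).mono'
      ((hw.pow_const _).aestronglyMeasurable.mul hFm) (ae_of_all _ fun ξ => ?_)
    rw [norm_mul, Complex.norm_cpow_real, hwn]
  have hcos : (Real.cos (Real.pi * γ / 2) : ℂ) ≠ 0 := by
    exact_mod_cast cos_pi_mul_div_two_ne_zero h0 h2 h1
  rw [rieszDeriv, Complex.ofReal_mul, Complex.ofReal_add, hf.leftRLDeriv_eq_integral h0 hfl hn,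
    hf.rightRLDeriv_eq_integral h0 hfl hn,
    ← integral_add (hint _ (by fun_prop) norm_two_pi_mul_I)
      (hint _ (by fun_prop) fun ξ => by rw [norm_neg, norm_two_pi_mul_I])]
  have : ∀ ξ : ℝ, Complex.exp (2 * Real.pi * x * ξ * Complex.I) *
      ((2 * Real.pi * ξ * Complex.I) ^ (γ : ℂ) * realFourier f ξ) +
      Complex.exp (2 * Real.pi * x * ξ * Complex.I) *
      ((-(2 * Real.pi * ξ * Complex.I)) ^ (γ : ℂ) * realFourier f ξ) =
      (2 * Real.cos (Real.pi * γ / 2)) * (Complex.exp (2 * Real.pi * x * ξ * Complex.I) *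
      (((|2 * Real.pi * ξ| ^ γ : ℝ) : ℂ) * realFourier f ξ)) := by
    intro ξ
    have h := cpow_mul_I_add_cpow_neg_mul_I h0 (2 * Real.pi * ξ)
    push_cast at h ⊢
    linear_combination (Complex.exp (2 * Real.pi * x * ξ * Complex.I) * realFourier f ξ) * h
  simp only [this]
  rw [integral_const_mul]
  have hc : ((-(1 / (2 * Real.cos (Real.pi * γ / 2))) : ℝ) : ℂ) *
      (2 * Real.cos (Real.pi * γ / 2)) = -1 := by
    push_cast at hcos ⊢
    field_simp
  rw [← mul_assoc, hc, neg_one_mul]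

end

/-! ### The centred difference as a Fourier multiplier -/

section

variable {N : ℕ} {f : ℝ → ℝ}

lemma HasIntegrableDerivs.exists_abs_iteratedDeriv_le (hf : HasIntegrableDerivs N f) {j : ℕ}
    (hj : j < N) : ∃ M, 0 ≤ M ∧ ∀ x, |iteratedDeriv j f x| ≤ M :=
  exists_abs_le_of_integrable_deriv (hf.hasDerivAt_iteratedDeriv hj)
    (hf.continuous_iteratedDeriv hj) (hf.integrable _ hj)

lemma HasIntegrableDerivs.summable_omegaCoeff_mul (hf : HasIntegrableDerivs N f) (hN : 1 ≤ N)
    {γ : ℝ} (h0 : 0 < γ) (h2 : γ < 2) (h : ℝ) (r : ℤ) (x : ℝ) :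
    Summable fun k : ℤ => omegaCoeff γ k * f (x - ((k : ℝ) + (r : ℝ)) * h) := by
  obtain ⟨M, -, hM⟩ := hf.exists_abs_iteratedDeriv_le (j := 0) (by omega)
  rw [iteratedDeriv_zero] at hM
  refine ((summable_omegaCoeff h0 h2).abs.mul_right M).of_norm_bounded fun k => ?_
  rw [norm_mul]
  exact mul_le_mul_of_nonneg_left (hM _) (norm_nonneg _)

lemma HasIntegrableDerivs.shiftedDiff_eq_integral (hf : HasIntegrableDerivs N f) (hN : 2 ≤ N)
    {γ : ℝ} (h0 : 0 < γ) (h2 : γ < 2) (h : ℝ) (r : ℤ) (x : ℝ) :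
    (shiftedDiff γ h r f x : ℂ) = ∫ ξ : ℝ, Complex.exp (2 * Real.pi * x * ξ * Complex.I) *
      (Complex.exp (-(r * (2 * Real.pi * ξ * h) * Complex.I)) *
        ((|2 * Real.sin (2 * Real.pi * ξ * h / 2)| ^ γ : ℝ) : ℂ) * realFourier f ξ) := by
  have hFi := hf.integrable_realFourier hN
  set F : ℤ → ℝ → ℂ := fun k ξ => omegaCoeff γ k *
    (Complex.exp (2 * Real.pi * (x - (k + r) * h : ℝ) * ξ * Complex.I) * realFourier f ξ) with hF
  have hFk : ∀ k, Integrable (F k) := fun k => (integrable_cexp_mul hFi _).const_mul _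
  have hnorm : ∀ k, ∫ ξ, ‖F k ξ‖ = |omegaCoeff γ k| * ∫ ξ, ‖realFourier f ξ‖ := by
    intro k
    rw [← integral_const_mul]
    refine integral_congr_ae (ae_of_all _ fun ξ => ?_)
    simp only [hF]
    rw [norm_mul, norm_mul, norm_cexp_two_pi_mul_I, one_mul, Complex.norm_real, Real.norm_eq_abs]
  have hsum : Summable fun k => ∫ ξ, ‖F k ξ‖ := by
    simp only [hnorm]
    exact (summable_omegaCoeff h0 h2).abs.mul_right _
  have hval : ∀ k, ∫ ξ, F k ξ = ((omegaCoeff γ k * f (x - ((k : ℝ) + (r : ℝ)) * h) : ℝ) : ℂ) := by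
    intro k
    have := hf.iteratedDeriv_eq_integral (j := 0) hN (x - (k + r) * h)
    simp only [iteratedDeriv_zero, pow_zero, one_mul] at this
    rw [Complex.ofReal_mul, this, ← integral_const_mul]
  have h1 := integral_tsum_of_summable_integral_norm hFk hsum
  simp only [hval] at h1
  rw [shiftedDiff, Complex.ofReal_tsum, h1]
  refine integral_congr_ae (ae_of_all _ fun ξ => ?_)
  have hs := (hasSum_omegaCoeff_mul_exp h0 h2 (-(2 * Real.pi * ξ * h / 2))).mul_left
    (Complex.exp (2 * Real.pi * x * ξ * Complex.I) *
      (Complex.exp (-(r * (2 * Real.pi * ξ * h) * Complex.I)) * realFourier f ξ))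
  rw [Real.sin_neg, mul_neg, abs_neg] at hs
  simp only
  refine (Eq.trans (tsum_congr fun k => ?_) hs.tsum_eq).trans (by ring)
  have e : Complex.exp (2 * Real.pi * (x - (k + r) * h : ℝ) * ξ * Complex.I) =
      Complex.exp (2 * Real.pi * x * ξ * Complex.I) *
        Complex.exp (-(r * (2 * Real.pi * ξ * h) * Complex.I)) *
        Complex.exp (2 * k * (-(2 * Real.pi * ξ * h / 2) : ℝ) * Complex.I) := by
    rw [← Complex.exp_add, ← Complex.exp_add]
    congr 1
    push_cast
    ring
  simp only [hF]
  rw [e]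
  ring

lemma sum_rhoWeight_mul {R : Type*} [CommRing R] [Algebra ℝ R] (γ : ℝ) (a : ℤ → R) :
    ∑ r ∈ Finset.Icc (-1 : ℤ) 1, algebraMap ℝ R (rhoWeight γ r) * a r =
      algebraMap ℝ R (γ / 12 + 1) * a 0 - algebraMap ℝ R (γ / 24) * (a 1 + a (-1)) := by
  have : Finset.Icc (-1 : ℤ) 1 = {-1, 0, 1} := by decide
  rw [this, Finset.sum_insert (by decide), Finset.sum_insert (by decide), Finset.sum_singleton]
  simp only [rhoWeight, if_true, if_neg (show (-1 : ℤ) ≠ 0 by decide),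
    if_neg (show (1 : ℤ) ≠ 0 by decide), map_neg]
  ring

/-- The symbol of the corrected difference: `∑ ϱ_r e^{-irθ} = 1 + (γ / 12) (1 - cos θ)`. -/
lemma sum_rhoWeight_mul_cexp (γ θ : ℝ) :
    ∑ r ∈ Finset.Icc (-1 : ℤ) 1, (rhoWeight γ r : ℂ) * Complex.exp (-(r * θ * Complex.I)) =
      ((1 + γ / 12 * (1 - Real.cos θ) : ℝ) : ℂ) := by
  have h := sum_rhoWeight_mul (R := ℂ) γ fun r => Complex.exp (-(r * θ * Complex.I))
  simp only [Complex.coe_algebraMap] at h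
  rw [h]
  push_cast
  rw [Complex.cos]
  simp
  ring

/-- For `γ < 2` the error is the Fourier integral of `f̂` against the difference of the symbols,
which is `O(h⁴ |ξ|^(γ + 4))`. -/
lemma HasIntegrableDerivs.exists_abs_rieszDeriv_sub_le (hf : HasIntegrableDerivs N f) {γ : ℝ}
    (h0 : 0 < γ) (h2 : γ < 2) (h1 : γ ≠ 1) (hN : γ + 5 < N) :
    ∃ C : ℝ, ∀ h : ℝ, 0 < h → ∀ x : ℝ,
      |rieszDeriv γ f x -
          (-h ^ (-γ) * ∑ r ∈ Finset.Icc (-1 : ℤ) 1, rhoWeight γ r * shiftedDiff γ h r f x)|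
        ≤ C * h ^ 4 := by
  obtain ⟨C, hC⟩ := exists_symbol_bound h0 h2
  have hN5 : 5 ≤ N := by
    have : (5 : ℝ) ≤ N := by linarith
    exact_mod_cast this
  have hFi := hf.integrable_realFourier (by omega)
  have hI4 := hf.integrable_rpow_mul_realFourier (s := γ + 4) (by linarith) (by linarith)
  have hIγ := hf.integrable_rpow_mul_realFourier (s := γ) h0.le (by linarith)
  refine ⟨C * ∫ ξ : ℝ, |2 * Real.pi * ξ| ^ (γ + 4) * ‖realFourier f ξ‖, fun h hh x => ?_⟩
  -- the error and its symbol
  set E := rieszDeriv γ f x -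
    (-h ^ (-γ) * ∑ r ∈ Finset.Icc (-1 : ℤ) 1, rhoWeight γ r * shiftedDiff γ h r f x) with hE
  set m : ℝ → ℝ := fun ξ => |2 * Real.pi * ξ| ^ γ -
    h ^ (-γ) * (|2 * Real.sin (2 * Real.pi * ξ * h / 2)| ^ γ *
      (1 + γ / 12 * (1 - Real.cos (2 * Real.pi * ξ * h)))) with hm
  have hmb : ∀ ξ, |m ξ| ≤ C * h ^ 4 * |2 * Real.pi * ξ| ^ (γ + 4) := by
    intro ξ
    have hb := hC (2 * Real.pi * ξ * h)
    rw [abs_mul (2 * Real.pi * ξ) h, abs_of_pos hh, Real.mul_rpow (abs_nonneg _) hh.le,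
      Real.mul_rpow (abs_nonneg _) hh.le] at hb
    have hhγ : 0 < h ^ (-γ) := by positivity
    have e1 : h ^ (-γ) * h ^ γ = 1 := by rw [← Real.rpow_add hh]; simp
    have e2 : h ^ (-γ) * h ^ (γ + 4) = h ^ 4 := by
      rw [← Real.rpow_add hh, neg_add_cancel_left]
      exact_mod_cast Real.rpow_natCast h 4
    have hmul := mul_le_mul_of_nonneg_left hb hhγ.le
    rw [← abs_of_pos hhγ, ← abs_mul, abs_of_pos hhγ] at hmul
    have l1 : h ^ (-γ) * (|2 * Real.pi * ξ| ^ γ * h ^ γ -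
        |2 * Real.sin (2 * Real.pi * ξ * h / 2)| ^ γ *
          (1 + γ / 12 * (1 - Real.cos (2 * Real.pi * ξ * h)))) = m ξ := by
      rw [hm]
      linear_combination |2 * Real.pi * ξ| ^ γ * e1
    have l2 : h ^ (-γ) * (C * (|2 * Real.pi * ξ| ^ (γ + 4) * h ^ (γ + 4))) =
        C * h ^ 4 * |2 * Real.pi * ξ| ^ (γ + 4) := by
      linear_combination (C * |2 * Real.pi * ξ| ^ (γ + 4)) * e2
    rwa [l1, l2] at hmul
  have hEint : (E : ℂ) = -∫ ξ : ℝ, Complex.exp (2 * Real.pi * x * ξ * Complex.I) *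
      ((m ξ : ℂ) * realFourier f ξ) := by
    have hi1 : Integrable fun ξ : ℝ => Complex.exp (2 * Real.pi * x * ξ * Complex.I) *
        (((|2 * Real.pi * ξ| ^ γ : ℝ) : ℂ) * realFourier f ξ) := by
      refine integrable_cexp_mul ?_ x
      refine hIγ.mono' (((Complex.measurable_ofReal.comp (by fun_prop)).aestronglyMeasurable).mul
        hFi.aestronglyMeasurable) (ae_of_all _ fun ξ => ?_)
      rw [norm_mul, Complex.norm_real, Real.norm_eq_abs, abs_of_nonneg (by positivity)]
    have hi2 : ∀ r : ℤ, Integrable fun ξ : ℝ => Complex.exp (2 * Real.pi * x * ξ * Complex.I) *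
        (Complex.exp (-(r * (2 * Real.pi * ξ * h) * Complex.I)) *
          ((|2 * Real.sin (2 * Real.pi * ξ * h / 2)| ^ γ : ℝ) : ℂ) * realFourier f ξ) := by
      intro r
      refine integrable_cexp_mul (hFi.bdd_mul (c := 2 ^ γ) ?_ (ae_of_all _ fun ξ => ?_)) x
      · have : Measurable fun ξ : ℝ => |2 * Real.sin (2 * Real.pi * ξ * h / 2)| ^ γ := by
          fun_prop
        exact (Continuous.aestronglyMeasurable (by fun_prop)).mul
          (Complex.measurable_ofReal.comp this).aestronglyMeasurable
      · have e : (-(r * (2 * Real.pi * ξ * h) * Complex.I) : ℂ) =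
            ((-(r * (2 * Real.pi * ξ * h)) : ℝ) : ℂ) * Complex.I := by
          push_cast; ring
        rw [norm_mul, e, Complex.norm_exp_ofReal_mul_I, one_mul, Complex.norm_real,
          Real.norm_eq_abs, abs_of_nonneg (by positivity)]
        refine Real.rpow_le_rpow (abs_nonneg _) ?_ h0.le
        rw [abs_mul, abs_two]
        linarith [Real.abs_sin_le_one (2 * Real.pi * ξ * h / 2)]
    have hsum : ((∑ r ∈ Finset.Icc (-1 : ℤ) 1, rhoWeight γ r * shiftedDiff γ h r f x : ℝ) : ℂ) =
        ∫ ξ : ℝ, ∑ r ∈ Finset.Icc (-1 : ℤ) 1, (rhoWeight γ r : ℂ) *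
          (Complex.exp (2 * Real.pi * x * ξ * Complex.I) *
        (Complex.exp (-(r * (2 * Real.pi * ξ * h) * Complex.I)) *
          ((|2 * Real.sin (2 * Real.pi * ξ * h / 2)| ^ γ : ℝ) : ℂ) * realFourier f ξ)) := by
      rw [integral_finsetSum _ fun r _ => (hi2 r).const_mul _]
      push_cast
      refine Finset.sum_congr rfl fun r _ => ?_
      rw [integral_const_mul, hf.shiftedDiff_eq_integral (by omega) h0 h2]
    have hi3 := integrable_finsetSum (Finset.Icc (-1 : ℤ) 1)
      fun r _ => (hi2 r).const_mul (rhoWeight γ r : ℂ)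
    rw [hE, Complex.ofReal_sub, Complex.ofReal_mul, hsum,
      hf.rieszDeriv_eq_integral h0 h2 h1 hN5, Complex.ofReal_neg, neg_mul, sub_neg_eq_add,
      ← integral_const_mul, neg_add_eq_sub, ← neg_sub, ← integral_sub hi1 (hi3.const_mul _)]
    congr 1
    refine integral_congr_ae (ae_of_all _ fun ξ => ?_)
    have hρ := sum_rhoWeight_mul_cexp γ (2 * Real.pi * ξ * h)
    have e : ∑ r ∈ Finset.Icc (-1 : ℤ) 1, (rhoWeight γ r : ℂ) *
          (Complex.exp (2 * Real.pi * x * ξ * Complex.I) *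
        (Complex.exp (-(r * (2 * Real.pi * ξ * h) * Complex.I)) *
          ((|2 * Real.sin (2 * Real.pi * ξ * h / 2)| ^ γ : ℝ) : ℂ) * realFourier f ξ)) =
        (∑ r ∈ Finset.Icc (-1 : ℤ) 1, (rhoWeight γ r : ℂ) *
          Complex.exp (-(r * (2 * Real.pi * ξ * h : ℝ) * Complex.I))) *
          (Complex.exp (2 * Real.pi * x * ξ * Complex.I) *
          ((|2 * Real.sin (2 * Real.pi * ξ * h / 2)| ^ γ : ℝ) : ℂ) * realFourier f ξ) := by
      rw [Finset.sum_mul]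
      refine Finset.sum_congr rfl fun r _ => ?_
      push_cast
      ring
    simp only
    rw [e, hρ]
    simp only [hm, Complex.ofReal_sub, Complex.ofReal_mul]
    ring
  rw [← Real.norm_eq_abs, ← Complex.norm_real, hEint, norm_neg]
  refine (norm_integral_le_of_norm_le (hI4.const_mul (C * h ^ 4)) (ae_of_all _ fun ξ => ?_)).trans_eq
    ?_
  · rw [norm_mul, norm_cexp_two_pi_mul_I, one_mul, norm_mul, Complex.norm_real, ← mul_assoc]
    exact mul_le_mul_of_nonneg_right (hmb ξ) (norm_nonneg _)
  · rw [integral_const_mul]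
    ring

end

/-! ### The case `γ = 2` -/

section

variable {N : ℕ} {f : ℝ → ℝ}

lemma hasSum_omegaCoeff_two_mul (a : ℤ → ℝ) :
    HasSum (fun k : ℤ => omegaCoeff 2 k * a k) (2 * a 0 - (a 1 + a (-1))) := by
  have hz : ∀ k : ℤ, k ∉ ({-1, 0, 1} : Finset ℤ) → omegaCoeff 2 k * a k = 0 := by
    intro k hk
    simp only [Finset.mem_insert, Finset.mem_singleton, not_or] at hk
    -- for `|k| ≥ 2` one of the two Gamma factors sits at a pole
    have hG : ∀ n : ℕ, Real.Gamma (-(n : ℝ)) = 0 := Real.Gamma_neg_nat_eq_zero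
    have : omegaCoeff 2 k = 0 := by
      rcases le_or_gt 2 k with h | h
      · obtain ⟨n, rfl⟩ := Int.eq_ofNat_of_zero_le (show 0 ≤ k by omega)
        obtain ⟨m, rfl⟩ := Nat.exists_eq_add_of_le (show 2 ≤ n by omega)
        have := hG m
        rw [omegaCoeff, show ((2 : ℝ) / 2 - (((2 + m : ℕ) : ℤ) : ℝ) + 1) = -(m : ℝ) by
          push_cast; ring, this]
        simp
      · obtain ⟨m, hm⟩ := Int.eq_ofNat_of_zero_le (show 0 ≤ -k - 2 by omega)
        obtain rfl : k = -(m : ℤ) - 2 := by omega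
        have := hG m
        rw [omegaCoeff, show ((2 : ℝ) / 2 + ((-(m : ℤ) - 2 : ℤ) : ℝ) + 1) = -(m : ℝ) by
          push_cast; ring, this]
        simp
    rw [this, zero_mul]
  have g2 : Real.Gamma 2 = 1 := Real.Gamma_two
  have g3 : Real.Gamma 3 = 2 := by
    rw [show (3 : ℝ) = 2 + 1 by norm_num, Real.Gamma_add_one two_ne_zero, g2, mul_one]
  have w0 : omegaCoeff 2 0 = 2 := by
    norm_num [omegaCoeff, g2, g3]
  have w1 : omegaCoeff 2 1 = -1 := by
    norm_num [omegaCoeff, g2, g3]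
  have h := hasSum_sum_of_ne_finset_zero (L := SummationFilter.unconditional ℤ) hz
  rw [Finset.sum_insert (by decide), Finset.sum_insert (by decide), Finset.sum_singleton,
    omegaCoeff_neg, w0, w1] at h
  convert h using 1
  ring

lemma HasIntegrableDerivs.leftRLDeriv_two (hf : HasIntegrableDerivs N f) (hN : 4 ≤ N) (x : ℝ) :
    leftRLDeriv 2 f x = iteratedDeriv 2 f x := by
  have hr : rlOrder 2 = 3 := by simp [rlOrder]
  have h0 : leftFracIntegral (2 - ((3 : ℕ) : ℝ) + 1) (iteratedDeriv 3 f) x =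
      iteratedDeriv 2 f x := by
    have hd : ∀ t : ℝ, HasDerivAt (fun t => -iteratedDeriv 2 f (x - t))
        (iteratedDeriv 3 f (x - t)) t := by
      intro t
      exact ((hf.hasDerivAt_iteratedDeriv (j := 2) (by omega)
        (x - t)).comp_const_sub x t).neg.congr_deriv (neg_neg _)
    have hi : Integrable fun t => iteratedDeriv 3 f (x - t) :=
      (hf.integrable 3 (by omega)).comp_sub_left x
    have hi2 : Integrable fun t => -iteratedDeriv 2 f (x - t) :=
      ((hf.integrable 2 (by omega)).comp_sub_left x).neg
    have ht := tendsto_zero_of_hasDerivAt_of_integrableOn_Ioi (a := 0)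
      (fun t _ => hd t) hi.integrableOn hi2.integrableOn
    have h := integral_Ioi_of_hasDerivAt_of_tendsto (a := 0)
      (hd 0).continuousAt.continuousWithinAt (fun t _ => hd t) hi.integrableOn ht
    rw [leftFracIntegral, show (2 - ((3 : ℕ) : ℝ) + 1) = 0 by norm_num]
    simpa using h
  rw [leftRLDeriv_eq hf zero_le_two (by omega), hr, h0]
  norm_num

lemma HasIntegrableDerivs.rieszDeriv_two (hf : HasIntegrableDerivs N f) (hN : 4 ≤ N) (x : ℝ) :
    rieszDeriv 2 f x = iteratedDeriv 2 f x := by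
  rw [rieszDeriv, rightRLDeriv_eq_leftRLDeriv_comp_neg, hf.leftRLDeriv_two hN,
    hf.comp_neg.leftRLDeriv_two hN, iteratedDeriv_comp_neg]
  have : Real.pi * 2 / 2 = Real.pi := by ring
  rw [this, Real.cos_pi]
  norm_num
  ring

lemma HasIntegrableDerivs.abs_sub_taylor_le (hf : HasIntegrableDerivs N f) (hN : 6 ≤ N) {M : ℝ}
    (hM : ∀ x, |iteratedDeriv 6 f x| ≤ M) (x t : ℝ) :
    |f (x + t) - ∑ k ∈ Finset.range 6, (k.factorial : ℝ)⁻¹ * t ^ k * iteratedDeriv k f x| ≤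
      M * t ^ 6 / 720 := by
  rcases eq_or_ne t 0 with rfl | ht
  · simp [Finset.sum_range_succ]
  · have hne : x ≠ x + t := by simpa using ht
    have hc : ContDiff ℝ ((5 : ℕ) + 1) f :=
      hf.contDiff.of_le (by exact_mod_cast hN)
    obtain ⟨y, -, hy⟩ := taylor_mean_remainder_lagrange_iteratedDeriv hne hc.contDiffOn
    rw [taylor_within_apply, add_sub_cancel_left] at hy
    have hu : UniqueDiffOn ℝ (Set.uIcc x (x + t)) :=
      uniqueDiffOn_Icc (by simpa using hne)
    have e : ∑ k ∈ Finset.range (5 + 1), ((k.factorial : ℝ)⁻¹ * t ^ k) •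
        iteratedDerivWithin k f (Set.uIcc x (x + t)) x =
        ∑ k ∈ Finset.range 6, (k.factorial : ℝ)⁻¹ * t ^ k * iteratedDeriv k f x := by
      refine Finset.sum_congr rfl fun k hk => ?_
      have hk' : k ≤ 5 + 1 := by have := Finset.mem_range.1 hk; omega
      rw [smul_eq_mul, iteratedDerivWithin_eq_iteratedDeriv hu
        (hc.of_le (by exact_mod_cast hk')).contDiffAt Set.left_mem_uIcc]
    rw [e] at hy
    rw [hy, abs_div, abs_mul, abs_of_nonneg (Even.pow_nonneg (by decide) t : 0 ≤ t ^ (5 + 1))]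
    have : |(((5 + 1).factorial : ℕ) : ℝ)| = 720 := by norm_num [Nat.factorial]
    rw [this]
    have := hM y
    have h6 : 0 ≤ t ^ 6 := by positivity
    gcongr

/-- For `γ = 2` the scheme is the five-point fourth-order difference for `f''`. -/
lemma HasIntegrableDerivs.exists_abs_rieszDeriv_two_sub_le (hf : HasIntegrableDerivs N f)
    (hN : 7 ≤ N) :
    ∃ C : ℝ, ∀ h : ℝ, 0 < h → ∀ x : ℝ,
      |rieszDeriv 2 f x -
          (-h ^ (-2 : ℝ) * ∑ r ∈ Finset.Icc (-1 : ℤ) 1, rhoWeight 2 r * shiftedDiff 2 h r f x)|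
        ≤ C * h ^ 4 := by
  obtain ⟨M, hM0, hM⟩ := hf.exists_abs_iteratedDeriv_le (j := 6) (by omega)
  refine ⟨M, fun h hh x => ?_⟩
  have hsd : ∀ r : ℤ, shiftedDiff 2 h r f x =
      2 * f (x - r * h) - (f (x - (r + 1) * h) + f (x - (r - 1) * h)) := by
    intro r
    have := (hasSum_omegaCoeff_two_mul fun k : ℤ => f (x - ((k : ℝ) + (r : ℝ)) * h)).tsum_eq
    rw [shiftedDiff, this]
    push_cast
    rw [zero_add, add_comm (1 : ℝ), neg_add_eq_sub]
  have hsum := sum_rhoWeight_mul (R := ℝ) 2 fun r => shiftedDiff 2 h r f x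
  simp only [Algebra.algebraMap_self, RingHom.id_apply] at hsum
  have hpow : h ^ (-2 : ℝ) = (h ^ 2)⁻¹ := by
    rw [Real.rpow_neg hh.le]
    norm_num
  rw [hf.rieszDeriv_two (by omega), hsum, hsd, hsd, hsd, hpow]
  have t1 := hf.abs_sub_taylor_le (by omega) hM x h
  have t2 := hf.abs_sub_taylor_le (by omega) hM x (-h)
  have t3 := hf.abs_sub_taylor_le (by omega) hM x (2 * h)
  have t4 := hf.abs_sub_taylor_le (by omega) hM x (-(2 * h))
  simp only [Finset.sum_range_succ, Finset.sum_range_zero, Nat.factorial, iteratedDeriv_zero,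
    abs_le] at t1 t2 t3 t4
  have a1 : x - ((-1 : ℤ) : ℝ) * h = x + h := by push_cast; ring
  have a2 : x - (((-1 : ℤ) : ℝ) + 1) * h = x := by push_cast; ring
  have a3 : x - (((-1 : ℤ) : ℝ) - 1) * h = x + 2 * h := by push_cast; ring
  have a4 : x - ((1 : ℤ) : ℝ) * h = x + -h := by push_cast; ring
  have a5 : x - (((1 : ℤ) : ℝ) + 1) * h = x + -(2 * h) := by push_cast; ring
  have a6 : x - (((1 : ℤ) : ℝ) - 1) * h = x := by push_cast; ring
  have a7 : x - ((0 : ℤ) : ℝ) * h = x := by push_cast; ring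
  have a8 : x - (((0 : ℤ) : ℝ) + 1) * h = x + -h := by push_cast; ring
  have a9 : x - (((0 : ℤ) : ℝ) - 1) * h = x + h := by push_cast; ring
  rw [a1, a2, a3, a4, a5, a6, a7, a8, a9]
  have hh2 : 0 < h ^ 2 := by positivity
  have key : |h ^ 2 * iteratedDeriv 2 f x + (7 / 6 * (2 * f x - (f (x + -h) + f (x + h))) -
      1 / 12 * (2 * f (x + -h) - (f (x + -(2 * h)) + f x) +
        (2 * f (x + h) - (f x + f (x + 2 * h)))))| ≤ M * h ^ 6 := by
    have : 0 ≤ M * h ^ 6 := by positivity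
    push_cast at t1 t2 t3 t4
    ring_nf at t1 t2 t3 t4 ⊢
    rw [abs_le]
    constructor <;> linarith [t1.1, t1.2, t2.1, t2.2, t3.1, t3.2, t4.1, t4.2]
  have e : iteratedDeriv 2 f x - -(h ^ 2)⁻¹ * ((2 / 12 + 1) * (2 * f x - (f (x + -h) + f (x + h))) -
      2 / 24 * (2 * f (x + -h) - (f (x + -(2 * h)) + f x) +
        (2 * f (x + h) - (f x + f (x + 2 * h))))) =
      (h ^ 2)⁻¹ * (h ^ 2 * iteratedDeriv 2 f x + (7 / 6 * (2 * f x - (f (x + -h) + f (x + h))) -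
      1 / 12 * (2 * f (x + -h) - (f (x + -(2 * h)) + f x) +
        (2 * f (x + h) - (f x + f (x + 2 * h)))))) := by
    field_simp
    ring
  rw [e, abs_mul, abs_of_pos (by positivity), inv_mul_le_iff₀ hh2]
  calc _ ≤ M * h ^ 6 := key
    _ = h ^ 2 * (M * h ^ 4) := by ring

end

theorem mainTheorem1 (f : ℝ → ℝ) (hf : ContDiff ℝ 7 f)
    (hint : ∀ j : ℕ, j ≤ 7 → Integrable (iteratedDeriv j f))
    (γ : ℝ) (hγ : γ ∈ Set.Ioo (0 : ℝ) 1 ∪ Set.Ioc (1 : ℝ) 2) :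
    RieszDifferentiable γ f ∧
    (∀ h : ℝ, 0 < h → ∀ (r : ℤ) (x : ℝ),
      Summable (fun k : ℤ => omegaCoeff γ k * f (x - ((k : ℝ) + (r : ℝ)) * h))) ∧
    ∃ C : ℝ, ∀ᶠ h : ℝ in 𝓝[>] 0, ∀ x : ℝ,
      |rieszDeriv γ f x -
          (-h ^ (-γ) * ∑ r ∈ Finset.Icc (-1 : ℤ) 1, rhoWeight γ r * shiftedDiff γ h r f x)|
        ≤ C * h ^ 4 := by
  have hF : HasIntegrableDerivs 7 f := ⟨hf, hint⟩
  have h0 : 0 < γ := by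
    rcases hγ with h | h
    · exact h.1
    · exact one_pos.trans h.1
  have h1 : γ ≠ 1 := by
    rcases hγ with h | h
    · exact h.2.ne
    · exact h.1.ne'
  have h2 : γ ≤ 2 := by
    rcases hγ with h | h
    · exact h.2.le.trans one_le_two
    · exact h.2
  have hn := rlOrder_le h2
  refine ⟨hF.rieszDifferentiable h0.le (by omega), ?_⟩
  rcases h2.eq_or_lt with rfl | h2
  · refine ⟨fun h _ r x =>
      (hasSum_omegaCoeff_two_mul fun k => f (x - ((k : ℝ) + (r : ℝ)) * h)).summable, ?_⟩
    obtain ⟨C, hC⟩ := hF.exists_abs_rieszDeriv_two_sub_le le_rfl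
    exact ⟨C, by filter_upwards [self_mem_nhdsWithin] with h hh using hC h hh⟩
  · refine ⟨fun h _ r x => hF.summable_omegaCoeff_mul (by omega) h0 h2 h r x, ?_⟩
    obtain ⟨C, hC⟩ := hF.exists_abs_rieszDeriv_sub_le h0 h2 h1 (by push_cast; linarith)
    exact ⟨C, by filter_upwards [self_mem_nhdsWithin] with h hh using hC h hh⟩
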